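/- Let $k\ge 1$ and $\mathbf n=(n_1,\dots,n_k)$ with all $n_i\ge 1$. For a complex Hilbert space $H$ let the regular polyball $\mathbf B_{\mathbf n}(H)$ be the set of tuples $\mathbf X=(X_{i,j})_{1\le i\le k,\,1\le j\le n_i}$ of bounded operators on $H$ such that $\|\sum_j X_{i,j}X_{i,j}^*\|<1$ for each $i$, $X_{s,a}X_{t,b}=X_{t,b}X_{s,a}$ whenever $s\ne t$, and $(\mathrm{id}-\Phi_{X_1})\circ\cdots\circ(\mathrm{id}-\Phi_{X_k})(I)$ is positive and invertible, where $\Phi_{X_i}(Y)=\sum_j X_{i,j}YX_{i,j}^*$; let $\mathbf B_{\mathbf n}(H)^-$ be its norm closure. For $\boldsymbol\alpha=(\alpha_1,\dots,\alpha_k)\in\mathbb F_{n_1}^+\times\cdots\times\mathbb F_{n_k}^+$ (free unital semigroups) put $\mathbf X_{\boldsymbol\alpha}=X_{1,\alpha_1}\cdots X_{k,\alpha_k}$ with $X_{i,g_{j_1}\cdots g_{j_p}}=X_{i,j_1}\cdots X_{i,j_p}$, and let $\Gamma_q=\{\boldsymbol\alpha:|\alpha_1|+\cdots+|\alpha_k|=q\}$,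 where $|\cdot|$ is the word length. Let $\mathbf S=(\mathbf S_{i,j})$ be the universal model, $\mathbf S_{i,j}=I\otimes\cdots\otimes S_{i,j}\otimes\cdots\otimes I$ (with $S_{i,j}$ in position $i$) on $F^2(\mathbb C^{n_1})\otimes\cdots\otimes F^2(\mathbb C^{n_k})$, where $S_{i,j}$ is the left creation operator by the $j$-th basis vector on the $i$-th full Fock space. Let $\omega(T)=\sup\{|\langle Th,h\rangle|:\|h\|=1\}$ be the numerical radius and $[x]$ the integer part of $x$; for $m=\infty$ read $\cos\frac{\pi}{[m/q]+2}$ as $1$. Let $m\in\{1,2,\dots\}\cup\{\infty\}$, let $K$ be a complex Hilbert space, $A_{(\boldsymbol\alpha)}\in B(K)$, and let $$F(\mathbf X)=\sum_{q=0}^m\sum_{\boldsymbol\alpha\in\Gamma_q}A_{(\boldsymbol\alpha)}\otimes\mathbf X_{\boldsymbol\alpha}$$ be a free holomorphic function on the polyball, i.e. its multi-homogeneous expansion (grouping the terms by $(|\alpha_1|,\dots,|\alpha_k|)\in\mathbb Z_+^k$) converges in the operator norm for every Hilbert space $H$ and every $\mathbf X\in\mathbf B_{\mathbf n}(H)$.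 Let $A_0$ be the coefficient of the empty multi-word, and assume $F(0)\ge 0$ and $\operatorname{Re}F(\mathbf X)\le I$ for all $\mathbf X\in\mathbf B_{\mathbf n}(H)$ and all $H$. Then: (1) For each integer $q$ with $1\le q\le m$, each Hilbert space $H$ and each $\mathbf X\in\mathbf B_{\mathbf n}(H)$, $$\omega\Big(\sum_{\boldsymbol\alpha\in\Gamma_q}A_{(\boldsymbol\alpha)}\otimes\mathbf X_{\boldsymbol\alpha}\Big)\le\omega\Big(\sum_{\boldsymbol\alpha\in\Gamma_q}A_{(\boldsymbol\alpha)}\otimes\mathbf S_{\boldsymbol\alpha}\Big)\le 2\|I-A_0\|\cos\frac{\pi}{[m/q]+2}.$$ (2) For each $l\in\{1,2,\dots\}\cup\{\infty\}$ the equation $\sum_{q=1}^l t^q\cos\frac{\pi}{[l/q]+2}=\frac12$ has a unique solution $t_l\in(0,1]$; moreover $t_l<1$ if $l\ge 2$, the sequence $(t_l)_{l=1}^\infty$ is strictly decreasing and converges to $\frac13$, and $t_\infty=\frac13$. (3) For each $r\in[0,t_m]$ and each infinite-dimensional Hilbert space $H$, $$\sum_{q=0}^m\ \sup_{\mathbf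 X\in r\mathbf B_{\mathbf n}(H)^-}\omega\Big(\sum_{\boldsymbol\alpha\in\Gamma_q}A_{(\boldsymbol\alpha)}\otimes\mathbf X_{\boldsymbol\alpha}\Big)=\sum_{q=0}^m\omega\Big(\sum_{\boldsymbol\alpha\in\Gamma_q}A_{(\boldsymbol\alpha)}\otimes\mathbf S_{\boldsymbol\alpha}\Big)r^q\le\|A_0\|+\|I-A_0\|,$$ where all suprema are finite and all series converge. -/

import Mathlib

open scoped TensorProduct Pointwise Topology

namespace NCPolyball

/-- The numerical radius `ω(T) = sup { |⟨T h, h⟩| : ‖h‖ = 1 }` of a bounded operator. -/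
noncomputable def numericalRadius {E : Type*} [NormedAddCommGroup E] [InnerProductSpace ℂ E]
    (T : E →L[ℂ] E) : ℝ :=
  ⨆ h : Metric.sphere (0 : E) 1, ‖inner ℂ (T (h : E)) (h : E)‖

section Polyball

variable {k : ℕ} (n : Fin k → ℕ)

/-- Tuples `X = (X_{i,j})`, `1 ≤ i ≤ k`, `1 ≤ j ≤ n_i`, of bounded operators on `E`, with the
product of the operator norm topologies. -/
abbrev OpTuple (E : Type*) [NormedAddCommGroup E] [InnerProductSpace ℂ E] : Type _ :=
  (i : Fin k) → Fin (n i) → (E →L[ℂ] E)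

/-- The map `Φ_{X_i}(Y) = ∑_j X_{i,j} Y X_{i,j}^*` on `B(E)` given by a row `(X_{i,1}, …, X_{i,l})`
of operators. -/
noncomputable def rowMap {E : Type*} [NormedAddCommGroup E] [InnerProductSpace ℂ E]
    [CompleteSpace E] {l : ℕ} (x : Fin l → (E →L[ℂ] E)) : Module.End ℂ (E →L[ℂ] E) :=
  ∑ j, LinearMap.mulLeft ℂ (x j) ∘ₗ LinearMap.mulRight ℂ (star (x j))

variable {n}

/-- The defect mapping `Δ_X = (id - Φ_{X_1}) ∘ ⋯ ∘ (id - Φ_{X_k})`. -/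
noncomputable def defectMap {E : Type*} [NormedAddCommGroup E] [InnerProductSpace ℂ E]
    [CompleteSpace E] (X : OpTuple n E) : Module.End ℂ (E →L[ℂ] E) :=
  (List.ofFn fun i => 1 - rowMap (X i)).prod

variable (n)

/-- The regular polyball `B_n(E)`: each row is a strict row contraction, the entries of different
rows commute, and `Δ_X(I)` is positive and invertible. -/
def polyball (E : Type*) [NormedAddCommGroup E] [InnerProductSpace ℂ E] [CompleteSpace E] :
    Set (OpTuple n E) :=
  {X | (∀ i, ‖∑ j, X i j * star (X i j)‖ < 1) ∧
    (∀ s t, s ≠ t → ∀ a b, Commute (X s a) (X t b)) ∧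
    IsStrictlyPositive (defectMap X 1)}

/-- The product `𝔽_{n_1}^+ × ⋯ × 𝔽_{n_k}^+` of free unital semigroups. -/
abbrev MultiWord : Type := (i : Fin k) → FreeMonoid (Fin (n i))

theorem multiDegree_finite (p : Fin k → ℕ) :
    {α : MultiWord n | ∀ i, (α i).length = p i}.Finite := by
  have h : ∀ i, {w : FreeMonoid (Fin (n i)) | w.length = p i}.Finite :=
    fun i => List.finite_length_eq (Fin (n i)) (p i)
  refine (Set.Finite.pi h).subset ?_
  intro α hα i _
  exact hα i

theorem degree_finite (q : ℕ) :
    {α : MultiWord n | ∑ i, (α i).length = q}.Finite := by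
  have h : ∀ i, {w : FreeMonoid (Fin (n i)) | w.length ≤ q}.Finite :=
    fun i => List.finite_length_le (Fin (n i)) q
  refine (Set.Finite.pi h).subset ?_
  intro α hα i _
  have hq : ∑ i, (α i).length = q := hα
  show (α i).length ≤ q
  rw [← hq]
  exact Finset.single_le_sum (f := fun i => (α i).length) (fun _ _ => Nat.zero_le _)
    (Finset.mem_univ i)

/-- `Λ_p`: the multi-words `(α_1, …, α_k)` with `|α_i| = p_i` for all `i`. -/
noncomputable def multiDegreeWords (p : Fin k → ℕ) : Finset (MultiWord n) :=
  (multiDegree_finite n p).toFinset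

/-- `Γ_q`: the multi-words `(α_1, …, α_k)` with `|α_1| + ⋯ + |α_k| = q`. -/
noncomputable def degreeWords (q : ℕ) : Finset (MultiWord n) :=
  (degree_finite n q).toFinset

variable {n}

/-- `X_α = X_{1,α_1} ⋯ X_{k,α_k}`, where `X_{i,α_i} = X_{i,j_1} ⋯ X_{i,j_p}` for
`α_i = g_{j_1} ⋯ g_{j_p}`. -/
noncomputable def wordEval {E : Type*} [NormedAddCommGroup E] [InnerProductSpace ℂ E]
    (X : OpTuple n E) (α : MultiWord n) : E →L[ℂ] E :=
  (List.ofFn fun i => FreeMonoid.lift (X i) (α i)).prod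

/-- The Hilbert tensor product `K ⊗ E`. -/
abbrev HilbertTensor (K E : Type*) [NormedAddCommGroup K] [InnerProductSpace ℂ K]
    [NormedAddCommGroup E] [InnerProductSpace ℂ E] : Type _ :=
  UniformSpace.Completion (K ⊗[ℂ] E)

/-- The operator `A ⊗ T` on the Hilbert tensor product, determined by `x ⊗ y ↦ A x ⊗ T y`. -/
noncomputable def opTensor {K E : Type*} [NormedAddCommGroup K] [InnerProductSpace ℂ K]
    [NormedAddCommGroup E] [InnerProductSpace ℂ E] (A : K →L[ℂ] K) (T : E →L[ℂ] E) :
    HilbertTensor K E →L[ℂ] HilbertTensor K E :=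
  (TensorProduct.mapL A T).completion

section Series

variable {K : Type*} [NormedAddCommGroup K] [InnerProductSpace ℂ K]
  (A : MultiWord n → (K →L[ℂ] K))

/-- The multi-homogeneous part `∑_{α ∈ Λ_p} A_α ⊗ X_α`. -/
noncomputable def multiPart {E : Type*} [NormedAddCommGroup E] [InnerProductSpace ℂ E]
    (p : Fin k → ℕ) (X : OpTuple n E) : HilbertTensor K E →L[ℂ] HilbertTensor K E :=
  ∑ α ∈ multiDegreeWords n p, opTensor (A α) (wordEval X α)

/-- The homogeneous part `∑_{α ∈ Γ_q} A_α ⊗ X_α`. -/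
noncomputable def homPart {E : Type*} [NormedAddCommGroup E] [InnerProductSpace ℂ E]
    (q : ℕ) (X : OpTuple n E) : HilbertTensor K E →L[ℂ] HilbertTensor K E :=
  ∑ α ∈ degreeWords n q, opTensor (A α) (wordEval X α)

/-- The formal power series `∑_α A_α ⊗ Z_α` is a free holomorphic function on the abstract polyball:
for every Hilbert space `H` and every `X ∈ B_n(H)` its multi-homogeneous expansion converges in the
operator norm. -/
def IsFreeHolomorphic : Prop :=
  ∀ (H : Type) [NormedAddCommGroup H] [InnerProductSpace ℂ H] [CompleteSpace H],
    ∀ X ∈ polyball n H, Summable fun p : Fin k → ℕ => multiPart A p X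

/-- The value `F(X) = ∑_{p ∈ ℕ^k} ∑_{α ∈ Λ_p} A_α ⊗ X_α`. -/
noncomputable def freeEval {E : Type*} [NormedAddCommGroup E] [InnerProductSpace ℂ E]
    (X : OpTuple n E) : HilbertTensor K E →L[ℂ] HilbertTensor K E :=
  ∑' p : Fin k → ℕ, multiPart A p X

end Series

end Polyball

section UniversalModel

variable {k : ℕ} (n : Fin k → ℕ)

/-- `F²(H_{n_1}) ⊗ ⋯ ⊗ F²(H_{n_k})`, realised through its orthonormal basis
`e_α = e^1_{α_1} ⊗ ⋯ ⊗ e^k_{α_k}` as the `ℓ²` space over multi-words. -/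
abbrev FockSpace : Type := lp (fun _ : MultiWord n => ℂ) 2

/-- The basis vector `e_α`. -/
noncomputable def fockBasis (α : MultiWord n) : FockSpace n := by
  classical exact lp.single 2 α 1

theorem orthonormal_fockBasis : Orthonormal ℂ (fockBasis n) := by
  classical
  rw [orthonormal_iff_ite]
  intro α β
  unfold fockBasis
  rw [lp.inner_single_left]
  by_cases h : α = β
  · subst h; simp
  · simp [h]

variable {n}

/-- Left multiplication by the generator `g_j` in the `i`-th coordinate. -/
def leftMul (i : Fin k) (j : Fin (n i)) (α : MultiWord n) : MultiWord n :=
  Function.update α i (FreeMonoid.of j * α i)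

theorem leftMul_injective (i : Fin k) (j : Fin (n i)) : Function.Injective (leftMul i j) := by
  intro α β h
  funext l
  have hl := congrFun h l
  by_cases e : l = i
  · subst e
    simpa [leftMul] using hl
  · simpa [leftMul, e] using hl

variable (n)

/-- The universal model `S = (S_{i,j})` of the polyball: `S_{i,j}` is the isometry with
`S_{i,j} e_α = e^1_{α_1} ⊗ ⋯ ⊗ (e^i_j ⊗ e^i_{α_i}) ⊗ ⋯ ⊗ e^k_{α_k}`, that is,
`I ⊗ ⋯ ⊗ (left creation operator by e^i_j) ⊗ ⋯ ⊗ I`. -/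
noncomputable def universalModel : OpTuple n (FockSpace n) := fun i j =>
  (((orthonormal_fockBasis n).comp (leftMul i j)
    (leftMul_injective i j)).orthogonalFamily.linearIsometry).toContinuousLinearMap

theorem universalModel_apply_basis (i : Fin k) (j : Fin (n i)) (α : MultiWord n) :
    universalModel n i j (fockBasis n α) = fockBasis n (leftMul i j α) := by
  classical
  have h := ((orthonormal_fockBasis n).comp (leftMul i j)
    (leftMul_injective i j)).orthogonalFamily.linearIsometry_apply_single (i := α) (1 : ℂ)
  have h2 : fockBasis n α = lp.single 2 α 1 := by
    unfold fockBasis; congr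
  rw [h2]
  refine h.trans ?_
  simp

end UniversalModel

/-- `cos (π / ([m/q] + 2))`, where `[m/q]` is the integer part; for `m = ∞` it is `cos 0 = 1`. -/
noncomputable def fejerCos (m : ℕ∞) (q : ℕ) : ℝ :=
  if m = ⊤ then 1 else Real.cos (Real.pi / (((m.toNat / q : ℕ) : ℝ) + 2))

/-- `t ∈ (0, 1]` solves `∑_{q=1}^m t^q cos (π / ([m/q] + 2)) = 1/2`. -/
def IsBohrSolution (m : ℕ∞) (t : ℝ) : Prop :=
  0 < t ∧ t ≤ 1 ∧
    HasSum (fun q : {q : ℕ // 1 ≤ q ∧ (q : ℕ∞) ≤ m} => t ^ (q : ℕ) * fejerCos m q) (1 / 2)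

end NCPolyball

open NCPolyball

/-!
Everything is reduced to the scalar forms `∑_{α ∈ Γ_q} ∑_β ⟨A_α g_β, g_{αβ}⟩` of finitely supported
families `g` of vectors of `K` indexed by multi-words (`shiftForm`). A constant `c` bounding such a
form by `c ∑ ‖g_β‖²` is recorded by `IsFormBound`.

*Comparison with the universal model.* The quadratic form of `∑_{α ∈ Γ_q} A_α ⊗ S_α` at
`∑_β g_β ⊗ e_β` is the shift form of `g`, so `ω(∑ A_α ⊗ S_α)` is a form bound. Conversely, for `X`
in the polyball the Poisson identity `∑_β X_β Δ_X(I) X_β^* = I` (`tendsto_sum_wordBox_defect`) turns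
a vector `h` of `K ⊗ E` into the square summable family `h_β = (I ⊗ D X_β^*) h`, with
`Δ_X(I) = D^* D`, and the quadratic form of `∑ A_α ⊗ X_α` at `h` into the shift form of `(h_β)`.
Expanding along a finite orthonormal system of `E`, every form bound is a bound for
`ω(∑ A_α ⊗ X_α)` (`IsFormBound.norm_inner_homPart_le`), and by continuity this persists on the norm
closure. Thus `ω(∑ A_α ⊗ S_α)` is the least form bound. On an infinite-dimensional space the
closure contains a copy `V S V^*` of the universal model, so the supremum over `r B_n(E)^-` is
attained there and equals `r^q ω(∑ A_α ⊗ S_α)`.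

*The Landau type inequality.* The points `r S`, `r < 1`, lie in the polyball. Testing `Re F(rS) ≤ I`
on finitely supported vectors, letting `r → 1`, and twisting `g_β` by `e^{i|β|θ}` gives
`Re ∑_{q ≥ 1} e^{iqθ} D_q ≤ Re ∑_β ⟨(I - A_0) g_β, g_β⟩` for all `θ`, where `D_q` is the shift form
of degree `q`. Fejér's inequality for nonnegative trigonometric polynomials
(`norm_coeff_le_of_trigPolynomial_nonneg`) then bounds `D_q`.

*The Bohr type inequality.* Summing the bounds `ω_q ≤ 2 ‖I - A_0‖ cos (π / ([m/q] + 2))` against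
`r^q`, `r ≤ t_m`, gives at most `‖I - A_0‖`, by the definition of `t_m`, and `ω_0 ≤ ‖A_0‖`.
-/

namespace NCPolyball

/-! ### Ordered products over commuting rows -/

theorem list_prod_ofFn_mul {M : Type*} [Monoid M] {k : ℕ} (a b : Fin k → M)
    (h : ∀ i j, i ≠ j → Commute (a i) (b j)) :
    (List.ofFn fun i => a i * b i).prod = (List.ofFn a).prod * (List.ofFn b).prod := by
  induction k with
  | zero => simp
  | succ k ih =>
    have hc : Commute (b 0) (List.ofFn fun i : Fin k => a i.succ).prod := by
      refine Commute.list_prod_right _ _ fun x hx => ?_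
      obtain ⟨i, rfl⟩ := List.mem_ofFn.1 hx
      exact (h i.succ 0 (Fin.succ_ne_zero i)).symm
    simp only [List.ofFn_succ, List.prod_cons]
    rw [ih _ _ fun i j hij => h i.succ j.succ fun e => hij (Fin.succ_injective _ e)]
    simp only [mul_assoc]
    rw [← mul_assoc (b 0), hc.eq, mul_assoc]

theorem map_list_prod_ofFn {M N : Type*} [Monoid M] [Monoid N] {k : ℕ} (f : M →* N)
    (a : Fin k → M) : f (List.ofFn a).prod = (List.ofFn fun i => f (a i)).prod := by
  rw [map_list_prod, List.map_ofFn]; rfl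

/-- A family is the ordered product of its components, each placed in its own coordinate. -/
theorem list_prod_ofFn_mulSingle {k : ℕ} {M : Fin k → Type*} [∀ i, Monoid (M i)]
    (a : ∀ i, M i) : (List.ofFn fun i => Pi.mulSingle i (a i)).prod = a := by
  have key : ∀ {k : ℕ} {M : Type _} [Monoid M] (i : Fin k) (x : M),
      (List.ofFn fun j => if j = i then x else 1).prod = x := by
    intro k M _ i x
    induction k with
    | zero => exact i.elim0
    | succ k ih =>
      rw [List.ofFn_succ, List.prod_cons]
      induction i using Fin.cases with
      | zero => simp [Fin.succ_ne_zero]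
      | succ i => simp [Fin.succ_inj, ih, (Fin.succ_ne_zero i).symm]
  funext i
  have h := map_list_prod_ofFn (Pi.evalMonoidHom M i) fun i => Pi.mulSingle i (a i)
  rw [Pi.evalMonoidHom_apply] at h
  rw [h, ← key i (a i)]
  congr 2
  · funext j
    by_cases hj : j = i
    · subst hj; simp
    · simp [hj]

theorem commute_lift {M ι : Type*} [Monoid M] (x : ι → M) (y : M) (h : ∀ j, Commute (x j) y)
    (w : FreeMonoid ι) : Commute (FreeMonoid.lift x w) y := by
  induction w using FreeMonoid.inductionOn' with
  | one => simp
  | of_mul j w ih => simpa using (h j).mul_left ih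

section

variable {k : ℕ} {n : Fin k → ℕ} {E : Type*} [NormedAddCommGroup E] [InnerProductSpace ℂ E]

theorem wordEval_mul {X : OpTuple n E}
    (hX : ∀ s t, s ≠ t → ∀ a b, Commute (X s a) (X t b)) (α β : MultiWord n) :
    wordEval X (α * β) = wordEval X α * wordEval X β := by
  unfold wordEval
  rw [← list_prod_ofFn_mul]
  · simp
  · intro i j hij
    exact commute_lift _ _ (fun a => (commute_lift _ _ (fun b => (hX i j hij a b).symm) _).symm) _

end

/-! ### The maps `Y ↦ ∑ⱼ xⱼ Y xⱼ*` as bounded operators -/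

section

variable {E : Type*} [NormedAddCommGroup E] [InnerProductSpace ℂ E] [CompleteSpace E]

/-- The monoid homomorphism sending an operator `a` to the bounded map `Y ↦ a Y a*`. -/
noncomputable def conjHom : (E →L[ℂ] E) →* ((E →L[ℂ] E) →L[ℂ] (E →L[ℂ] E)) where
  toFun a := (ContinuousLinearMap.mul ℂ (E →L[ℂ] E) a).comp
    ((ContinuousLinearMap.mul ℂ (E →L[ℂ] E)).flip (star a))
  map_one' := by ext; simp
  map_mul' a b := by
    refine ContinuousLinearMap.ext fun Y => ?_
    simp [mul_assoc]

theorem conjHom_apply (a Y : E →L[ℂ] E) : conjHom a Y = a * Y * star a := by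
  simp [conjHom, mul_assoc]

/-- `rowMap` as a bounded operator on `B(E)`. -/
noncomputable def rowMapL {l : ℕ} (x : Fin l → (E →L[ℂ] E)) :
    (E →L[ℂ] E) →L[ℂ] (E →L[ℂ] E) :=
  ∑ j, conjHom (x j)

theorem rowMapL_apply {l : ℕ} (x : Fin l → (E →L[ℂ] E)) (Y : E →L[ℂ] E) :
    rowMapL x Y = ∑ j, x j * Y * star (x j) := by
  simp [rowMapL, conjHom_apply]

theorem rowMap_apply {l : ℕ} (x : Fin l → (E →L[ℂ] E)) (Y : E →L[ℂ] E) :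
    rowMap x Y = ∑ j, x j * Y * star (x j) := by
  simp [rowMap, LinearMap.sum_apply, mul_assoc]

theorem toLinearMap_rowMapL {l : ℕ} (x : Fin l → (E →L[ℂ] E)) :
    (rowMapL x : (E →L[ℂ] E) →ₗ[ℂ] (E →L[ℂ] E)) = rowMap x := by
  ext1 Y
  rw [rowMap_apply, ContinuousLinearMap.coe_coe, rowMapL_apply]

/-- The norm of `Φ_x` on `B(E)` is attained at the identity; only `≤` is needed. The bound on
`⟨Φ_x(Y) u, v⟩ = ∑_j ⟨Y x_j^* u, x_j^* v⟩` with `v = Φ_x(Y) u` is the Cauchy-Schwarz inequality. -/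
theorem norm_rowMapL_le {l : ℕ} (x : Fin l → (E →L[ℂ] E)) :
    ‖rowMapL x‖ ≤ ‖∑ j, x j * star (x j)‖ := by
  have hrow : ∀ u : E, ∑ j, ‖star (x j) u‖ ^ 2 ≤ ‖∑ j, x j * star (x j)‖ * ‖u‖ ^ 2 := by
    intro u
    have h1 : ∀ j, ‖star (x j) u‖ ^ 2 = RCLike.re (inner ℂ ((x j * star (x j)) u) u) := by
      intro j
      rw [← inner_self_eq_norm_sq (𝕜 := ℂ), ContinuousLinearMap.star_eq_adjoint,
        ContinuousLinearMap.adjoint_inner_right]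
      rfl
    simp_rw [h1]
    rw [← map_sum, ← sum_inner, ← sum_apply]
    refine (RCLike.re_le_norm _).trans ((norm_inner_le_norm _ _).trans ?_)
    rw [pow_two, ← mul_assoc]
    gcongr
    exact ContinuousLinearMap.le_opNorm _ _
  refine ContinuousLinearMap.opNorm_le_bound _ (norm_nonneg _) fun Y => ?_
  rw [rowMapL_apply]
  refine ContinuousLinearMap.opNorm_le_bound _ (by positivity) fun u => ?_
  set Q := ∑ j, x j * star (x j)
  set v := (∑ j, x j * Y * star (x j)) u with hv
  have hsq : ‖v‖ ^ 2 ≤ ‖Y‖ * (‖Q‖ * ‖u‖ * ‖v‖) := by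
    calc ‖v‖ ^ 2 = ‖∑ j, inner ℂ (Y (star (x j) u)) (star (x j) v)‖ := by
          have : ∑ j, inner ℂ (Y (star (x j) u)) (star (x j) v) = inner ℂ v v := by
            conv_rhs => enter [2]; rw [hv]
            rw [sum_apply, sum_inner]
            refine Finset.sum_congr rfl fun j _ => ?_
            rw [ContinuousLinearMap.star_eq_adjoint, ContinuousLinearMap.adjoint_inner_right]
            rfl
          rw [this, inner_self_eq_norm_sq_to_K]; simp
      _ ≤ ∑ j, ‖Y‖ * (‖star (x j) u‖ * ‖star (x j) v‖) := by
          refine (norm_sum_le _ _).trans (Finset.sum_le_sum fun j _ => ?_)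
          refine (norm_inner_le_norm _ _).trans ?_
          rw [← mul_assoc]
          gcongr
          exact ContinuousLinearMap.le_opNorm _ _
      _ ≤ ‖Y‖ * (‖Q‖ * ‖u‖ * ‖v‖) := by
          rw [← Finset.mul_sum]
          refine mul_le_mul_of_nonneg_left ?_ (norm_nonneg _)
          refine abs_le_of_sq_le_sq' ?_ (by positivity) |>.2
          refine (Finset.sum_mul_sq_le_sq_mul_sq _ _ _).trans ?_
          calc _ ≤ (‖Q‖ * ‖u‖ ^ 2) * (‖Q‖ * ‖v‖ ^ 2) := by
                gcongr
                · exact hrow u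
                · exact hrow v
            _ = _ := by ring
  rcases (norm_nonneg v).eq_or_lt with h0 | h0
  · rw [← h0]; positivity
  · nlinarith [hsq, h0]

/-! ### The Poisson identity -/

/-- Prepending a letter to a word. -/
def consWord (l : ℕ) : Fin l × FreeMonoid (Fin l) ↪ FreeMonoid (Fin l) where
  toFun p := FreeMonoid.of p.1 * p.2
  inj' p q h := by
    have := List.cons.inj
      (show p.1 :: FreeMonoid.toList p.2 = q.1 :: FreeMonoid.toList q.2 from h)
    exact Prod.ext this.1 this.2

theorem consWord_apply {l : ℕ} (p : Fin l × FreeMonoid (Fin l)) :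
    consWord l p = FreeMonoid.of p.1 * p.2 := rfl

/-- The words of length less than `N`. -/
def wordsBelow (l : ℕ) : ℕ → Finset (FreeMonoid (Fin l))
  | 0 => ∅
  | N + 1 => Finset.cons 1 ((Finset.univ ×ˢ wordsBelow l N).map (consWord l)) (by
      simp only [Finset.mem_map, not_exists, not_and]
      intro p _ h
      have := congrArg FreeMonoid.length h
      simp [consWord_apply] at this)

theorem mem_wordsBelow {l N : ℕ} {w : FreeMonoid (Fin l)} :
    w ∈ wordsBelow l N ↔ w.length < N := by
  induction N generalizing w with
  | zero => simp [wordsBelow]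
  | succ N ih =>
    rw [wordsBelow]
    induction w using FreeMonoid.casesOn with
    | one => simp
    | of_mul j w =>
      simp only [Finset.mem_cons, Finset.mem_map, Finset.mem_product, Finset.mem_univ, true_and,
        consWord_apply, Prod.exists, FreeMonoid.length_mul, FreeMonoid.length_of]
      constructor
      · rintro (h | ⟨a, b, hb, h⟩)
        · exact absurd (congrArg FreeMonoid.length h) (by simp)
        · have := congrArg FreeMonoid.length h
          simp only [FreeMonoid.length_mul, FreeMonoid.length_of] at this
          have := ih.1 hb
          omega
      · intro h
        exact Or.inr ⟨j, w, ih.2 (by omega), rfl⟩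

theorem sum_wordsBelow_conjHom_lift {l : ℕ} (x : Fin l → (E →L[ℂ] E)) (N : ℕ) :
    ∑ w ∈ wordsBelow l N, conjHom (FreeMonoid.lift x w) = ∑ p ∈ Finset.range N, rowMapL x ^ p := by
  induction N with
  | zero => simp [wordsBelow]
  | succ N ih =>
    rw [wordsBelow, Finset.sum_cons, Finset.sum_map, Finset.sum_product, geom_sum_succ, ← ih,
      add_comm, rowMapL, Finset.sum_mul_sum]
    simp [consWord_apply]

variable {k : ℕ} {n : Fin k → ℕ}

variable (n) in
/-- The multi-words all of whose components have length less than `N`. -/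
def wordBox (N : ℕ) : Finset (MultiWord n) :=
  Fintype.piFinset fun i => wordsBelow (n i) N

theorem mem_wordBox {N : ℕ} {α : MultiWord n} :
    α ∈ wordBox n N ↔ ∀ i, (α i).length < N := by
  simp [wordBox, mem_wordsBelow]

theorem wordBox_mono : Monotone (wordBox n) := fun _ _ h _ hα =>
  mem_wordBox.2 fun i => (mem_wordBox.1 hα i).trans_le h

theorem tendsto_wordBox : Filter.Tendsto (wordBox n) Filter.atTop Filter.atTop := by
  refine Filter.tendsto_atTop_finset_of_monotone wordBox_mono fun α => ?_
  exact ⟨∑ i, (α i).length + 1, mem_wordBox.2 fun i => Nat.lt_succ_of_le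
    (Finset.single_le_sum (f := fun i => (α i).length) (fun _ _ => Nat.zero_le _)
      (Finset.mem_univ i))⟩

theorem sum_wordBox_conjHom (X : OpTuple n E) (N : ℕ) :
    ∑ β ∈ wordBox n N, conjHom (wordEval X β) =
      (List.ofFn fun i => ∑ p ∈ Finset.range N, rowMapL (X i) ^ p).prod := by
  have h := (MultilinearMap.mkPiAlgebraFin ℂ k ((E →L[ℂ] E) →L[ℂ] (E →L[ℂ] E))).map_sum_finset
    (fun i w => conjHom (FreeMonoid.lift (X i) w)) (fun i => wordsBelow (n i) N)
  simp only [MultilinearMap.mkPiAlgebraFin_apply, sum_wordsBelow_conjHom_lift] at h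
  rw [h, wordBox]
  refine Finset.sum_congr rfl fun β _ => ?_
  rw [wordEval, map_list_prod_ofFn]

theorem commute_rowMapL {l l' : ℕ} {x : Fin l → (E →L[ℂ] E)} {y : Fin l' → (E →L[ℂ] E)}
    (h : ∀ a b, Commute (x a) (y b)) : Commute (rowMapL x) (rowMapL y) :=
  Commute.sum_left _ _ _ fun a _ => Commute.sum_right _ _ _ fun b _ => (h a b).map conjHom

/-- The defect operator as the value at `1` of a product in the Banach algebra of bounded maps on
`B(E)`, where limits can be taken. -/
theorem defectMap_apply_one (X : OpTuple n E) :
    defectMap X 1 = (List.ofFn fun i => 1 - rowMapL (X i)).prod 1 := by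
  have h : ContinuousLinearMap.toLinearMapRingHom (List.ofFn fun i => 1 - rowMapL (X i)).prod
      = defectMap X := by
    rw [map_list_prod, List.map_ofFn, defectMap]
    congr 2
    funext i
    rw [← toLinearMap_rowMapL]
    rfl
  rw [← h]; rfl

/-- The geometric series of the commuting strict contractions `Φ_{X_i}` inverts the defect map:
the operators `X_β Δ_X(I) X_β^*` sum to the identity, in norm along boxes of multi-words. -/
theorem tendsto_sum_wordBox_defect {X : OpTuple n E} (hX : X ∈ polyball n E) :
    Filter.Tendsto (fun N => ∑ β ∈ wordBox n N,
      wordEval X β * defectMap X 1 * star (wordEval X β)) Filter.atTop (𝓝 1) := by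
  obtain ⟨hrow, hcomm, -⟩ := hX
  have hpow : ∀ i, Filter.Tendsto (fun N => 1 - rowMapL (X i) ^ N) Filter.atTop (𝓝 1) := by
    intro i
    have := tendsto_pow_atTop_nhds_zero_of_norm_lt_one ((norm_rowMapL_le (X i)).trans_lt (hrow i))
    simpa using tendsto_const_nhds.sub this
  have hprod := ((ContinuousMultilinearMap.mkPiAlgebraFin ℂ k
    ((E →L[ℂ] E) →L[ℂ] (E →L[ℂ] E))).cont.tendsto (fun _ => 1)).comp (tendsto_pi_nhds.2 hpow)
  have heval := ((ContinuousLinearMap.apply ℂ (E →L[ℂ] E) (1 : E →L[ℂ] E)).continuous.tendsto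
    _).comp hprod
  have h1 : (List.ofFn fun _ : Fin k => (1 : (E →L[ℂ] E) →L[ℂ] (E →L[ℂ] E))).prod = 1 := by
    simp
  refine Filter.Tendsto.congr (fun N => ?_) (heval.trans_eq ?_)
  · have hsum : ∑ β ∈ wordBox n N, wordEval X β * defectMap X 1 * star (wordEval X β)
        = (∑ β ∈ wordBox n N, conjHom (wordEval X β)) (defectMap X 1) := by
      rw [sum_apply]
      exact Finset.sum_congr rfl fun β _ => (conjHom_apply _ _).symm
    rw [hsum, sum_wordBox_conjHom, defectMap_apply_one, ← mul_apply_eq_comp,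
      ← list_prod_ofFn_mul]
    · simp only [geom_sum_mul_neg]
      rfl
    · intro i j hij
      refine Commute.sum_left _ _ _ fun p _ => ?_
      exact ((Commute.one_right _).sub_right (commute_rowMapL (hcomm i j hij))).pow_left p
  · change 𝓝 ((List.ofFn fun _ : Fin k => (1 : (E →L[ℂ] E) →L[ℂ] (E →L[ℂ] E))).prod 1) = 𝓝 1
    rw [h1]
    rfl
end

/-! ### Operators on the Hilbert tensor product -/

section

variable {K E : Type*} [NormedAddCommGroup K] [InnerProductSpace ℂ K]
  [NormedAddCommGroup E] [InnerProductSpace ℂ E]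

theorem opTensor_coe (A : K →L[ℂ] K) (T : E →L[ℂ] E) (x : K ⊗[ℂ] E) :
    opTensor A T (x : HilbertTensor K E) = (TensorProduct.mapL A T x : K ⊗[ℂ] E) := by
  simp only [opTensor, ContinuousLinearMap.completion_apply_coe]

theorem hilbertTensor_ext {S T : HilbertTensor K E →L[ℂ] HilbertTensor K E}
    (h : ∀ x : K ⊗[ℂ] E, S x = T x) : S = T :=
  ContinuousLinearMap.ext fun x => congrFun
    (UniformSpace.Completion.ext S.continuous T.continuous h) x

theorem opTensor_mul (A A' : K →L[ℂ] K) (T T' : E →L[ℂ] E) :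
    opTensor (A * A') (T * T') = opTensor A T * opTensor A' T' := by
  refine hilbertTensor_ext fun x => ?_
  rw [mul_apply_eq_comp, opTensor_coe, opTensor_coe, opTensor_coe, TensorProduct.mapL_mul]
  rfl

theorem norm_opTensor_le (A : K →L[ℂ] K) (T : E →L[ℂ] E) : ‖opTensor A T‖ ≤ ‖A‖ * ‖T‖ := by
  refine ContinuousLinearMap.opNorm_le_bound _ (by positivity) fun x => ?_
  induction x using UniformSpace.Completion.induction_on with
  | hp => exact isClosed_le (by fun_prop) (by fun_prop)
  | ih x =>
    rw [opTensor_coe, UniformSpace.Completion.norm_coe, UniformSpace.Completion.norm_coe]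
    exact (ContinuousLinearMap.le_opNorm _ _).trans
      (mul_le_mul_of_nonneg_right (TensorProduct.norm_mapL_le A T) (norm_nonneg _))

/-- `T ↦ A ⊗ T` as a bounded linear map. -/
noncomputable def opTensorL (A : K →L[ℂ] K) :
    (E →L[ℂ] E) →L[ℂ] (HilbertTensor K E →L[ℂ] HilbertTensor K E) :=
  LinearMap.mkContinuous
    { toFun := fun T => opTensor A T
      map_add' := fun S T => hilbertTensor_ext fun x => by
        rw [add_apply, opTensor_coe, opTensor_coe, opTensor_coe, TensorProduct.mapL_add_right,
          add_apply, UniformSpace.Completion.coe_add]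
      map_smul' := fun c T => hilbertTensor_ext fun x => by
        rw [RingHom.id_apply, smul_apply, opTensor_coe, opTensor_coe,
          TensorProduct.mapL_smul_right, smul_apply, UniformSpace.Completion.coe_smul] }
    ‖A‖ (norm_opTensor_le A)

theorem opTensorL_apply (A : K →L[ℂ] K) (T : E →L[ℂ] E) : opTensorL A T = opTensor A T := rfl

theorem opTensor_one_one : opTensor (1 : K →L[ℂ] K) (1 : E →L[ℂ] E) = 1 :=
  hilbertTensor_ext fun x => by
    rw [opTensor_coe]
    simp

theorem inner_opTensor_left [CompleteSpace K] [CompleteSpace E] (A : K →L[ℂ] K) (T : E →L[ℂ] E)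
    (x y : HilbertTensor K E) :
    inner ℂ (opTensor A T x) y = inner ℂ x (opTensor (star A) (star T) y) := by
  induction x, y using UniformSpace.Completion.induction_on₂ with
  | hp => exact isClosed_eq (by fun_prop) (by fun_prop)
  | ih x y =>
    rw [opTensor_coe, opTensor_coe, UniformSpace.Completion.inner_coe,
      UniformSpace.Completion.inner_coe]
    induction x using TensorProduct.induction_on with
    | zero => simp
    | add x x' hx hx' => rw [map_add, inner_add_left, inner_add_left, hx, hx']
    | tmul a b =>
      induction y using TensorProduct.induction_on with
      | zero => simp
      | add y y' hy hy' => rw [map_add, inner_add_right, inner_add_right, hy, hy']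
      | tmul c d =>
        rw [TensorProduct.mapL_tmul, TensorProduct.mapL_tmul, TensorProduct.inner_tmul,
          TensorProduct.inner_tmul, ContinuousLinearMap.star_eq_adjoint,
          ContinuousLinearMap.star_eq_adjoint, ContinuousLinearMap.adjoint_inner_right,
          ContinuousLinearMap.adjoint_inner_right]

end

/-! ### The numerical radius -/

section

variable {E : Type*} [NormedAddCommGroup E] [InnerProductSpace ℂ E]

theorem bddAbove_numericalRadius (T : E →L[ℂ] E) :
    BddAbove (Set.range fun h : Metric.sphere (0 : E) 1 => ‖inner ℂ (T (h : E)) (h : E)‖) := by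
  refine ⟨‖T‖, ?_⟩
  rintro _ ⟨⟨h, hh⟩, rfl⟩
  have h1 : ‖h‖ = 1 := by simpa using hh
  refine (norm_inner_le_norm _ _).trans ?_
  simpa [h1] using T.le_opNorm h

theorem numericalRadius_nonneg (T : E →L[ℂ] E) : 0 ≤ numericalRadius T :=
  Real.iSup_nonneg fun _ => norm_nonneg _

theorem norm_inner_le_numericalRadius (T : E →L[ℂ] E) (h : E) :
    ‖inner ℂ (T h) h‖ ≤ numericalRadius T * ‖h‖ ^ 2 := by
  rcases eq_or_ne h 0 with rfl | h0
  · simp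
  have hpos : 0 < ‖h‖ := norm_pos_iff.2 h0
  set u : E := ((‖h‖⁻¹ : ℝ) : ℂ) • h with hu
  have hu1 : ‖u‖ = 1 := by
    rw [hu, norm_smul, Complex.norm_real, norm_inv, norm_norm, inv_mul_cancel₀ hpos.ne']
  have hhu : h = ((‖h‖ : ℝ) : ℂ) • u := by
    rw [hu, smul_smul, ← Complex.ofReal_mul, mul_inv_cancel₀ hpos.ne']
    simp
  have h1 := le_ciSup (bddAbove_numericalRadius T) ⟨u, by simp [hu1]⟩
  have h2 : ‖inner ℂ (T h) h‖ = ‖h‖ ^ 2 * ‖inner ℂ (T u) u‖ := by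
    conv_lhs => rw [hhu, map_smul, inner_smul_left, inner_smul_right]
    simp [pow_two, mul_assoc]
  rw [h2, mul_comm]
  exact mul_le_mul_of_nonneg_right h1 (by positivity)

theorem numericalRadius_le {T : E →L[ℂ] E} {c : ℝ} (hc : 0 ≤ c)
    (h : ∀ x, ‖inner ℂ (T x) x‖ ≤ c * ‖x‖ ^ 2) : numericalRadius T ≤ c := by
  refine Real.iSup_le (fun x => ?_) hc
  have h1 : ‖(x : E)‖ = 1 := by simp
  simpa [h1] using h x

end

/-! ### Shift forms -/

section

variable {k : ℕ} {n : Fin k → ℕ}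

/-- The compression to the multi-words in `B` of the form `∑_β ⟨C_α g_β, g_{αβ}⟩`. -/
noncomputable def shiftForm {G : Type*} [NormedAddCommGroup G] [InnerProductSpace ℂ G]
    (C : MultiWord n → (G →L[ℂ] G)) (α : MultiWord n) (B : Finset (MultiWord n))
    (g : MultiWord n → G) : ℂ := by
  classical exact ∑ β ∈ B, if α * β ∈ B then inner ℂ (C α (g β)) (g (α * β)) else 0

/-- The finite-dimensional expression of the bound `ω(∑_{α ∈ Γ_q} C_α ⊗ S_α) ≤ c`: all finite
compressions of the form `∑_{α ∈ Γ_q} ∑_β ⟨C_α g_β, g_{αβ}⟩` are bounded by `c ∑_β ‖g_β‖²`. -/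
def IsFormBound {G : Type*} [NormedAddCommGroup G] [InnerProductSpace ℂ G]
    (C : MultiWord n → (G →L[ℂ] G)) (q : ℕ) (c : ℝ) : Prop :=
  ∀ (B : Finset (MultiWord n)) (g : MultiWord n → G),
    ‖∑ α ∈ degreeWords n q, shiftForm C α B g‖ ≤ c * ∑ β ∈ B, ‖g β‖ ^ 2

theorem continuous_shiftForm {G : Type*} [NormedAddCommGroup G] [InnerProductSpace ℂ G]
    (C : MultiWord n → (G →L[ℂ] G)) (α : MultiWord n) (B : Finset (MultiWord n)) :
    Continuous (shiftForm C α B) := by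
  unfold shiftForm
  refine continuous_finsetSum _ fun β _ => ?_
  split_ifs <;> fun_prop

variable {K E : Type*} [NormedAddCommGroup K] [InnerProductSpace ℂ K]
  [NormedAddCommGroup E] [InnerProductSpace ℂ E]

/-- Finitely many elements of an algebraic tensor product have a common expansion along a finite
orthonormal system of the right factor. -/
theorem exists_orthonormal_expansion (B : Finset (MultiWord n)) (g : MultiWord n → K ⊗[ℂ] E) :
    ∃ (d : ℕ) (e : Fin d → E) (c : Fin d → MultiWord n → K), Orthonormal ℂ e ∧
      ∀ β ∈ B, g β = ∑ i, c i β ⊗ₜ[ℂ] e i := by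
  classical
  obtain ⟨N, hN, hsub⟩ := TensorProduct.exists_finite_submodule_right_of_setFinite
    (R := ℂ) (g '' B) (B.finite_toSet.image g)
  have : FiniteDimensional ℂ N := hN
  have hex : ∀ β ∈ B, ∃ b : Fin (Module.finrank ℂ N) →₀ K,
      g β = ∑ i, b i ⊗ₜ[ℂ] ((stdOrthonormalBasis ℂ N i : N) : E) := by
    intro β hβ
    obtain ⟨x, hx⟩ := hsub ⟨β, hβ, rfl⟩
    obtain ⟨b, hb⟩ := TensorProduct.eq_repr_basis_right (stdOrthonormalBasis ℂ N).toBasis x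
    refine ⟨b, ?_⟩
    rw [← hx, ← hb, Finsupp.sum_fintype _ _ (by simp), map_sum]
    simp
  choose! b hb using hex
  exact ⟨_, fun i => (stdOrthonormalBasis ℂ N i : N), fun i β => b β i,
    (stdOrthonormalBasis ℂ N).orthonormal.comp_linearIsometry N.subtypeₗᵢ, hb⟩

theorem inner_sum_tmul_orthonormal {ι : Type*} [Fintype ι] {e : ι → E} (he : Orthonormal ℂ e)
    (x y : ι → K) :
    inner ℂ (∑ i, x i ⊗ₜ[ℂ] e i) (∑ i, y i ⊗ₜ[ℂ] e i) = ∑ i, inner ℂ (x i) (y i) := by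
  classical
  simp [sum_inner, inner_sum, orthonormal_iff_ite.1 he]

/-- Form bounds are stable under ampliation: along an orthonormal system of `E` the form of the
coefficients `A_α ⊗ I` is a sum of forms of the coefficients `A_α`. -/
theorem IsFormBound.opTensor_one {A : MultiWord n → (K →L[ℂ] K)} {q : ℕ} {c : ℝ}
    (h : IsFormBound A q c) :
    IsFormBound (fun α => opTensor (A α) (1 : E →L[ℂ] E)) q c := by
  classical
  intro B g
  have hdense : DenseRange fun (f : MultiWord n → K ⊗[ℂ] E) (β : MultiWord n) =>
      (f β : HilbertTensor K E) :=
    DenseRange.piMap fun _ => UniformSpace.Completion.denseRange_coe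
  refine hdense.induction_on g ?_ fun f => ?_
  · refine isClosed_le ?_ (by fun_prop)
    exact (continuous_finsetSum _ fun α _ => continuous_shiftForm _ α B).norm
  obtain ⟨d, e, x, he, hf⟩ := exists_orthonormal_expansion B f
  have hform : ∀ α, shiftForm (fun α => opTensor (A α) (1 : E →L[ℂ] E)) α B
      (fun β => (f β : HilbertTensor K E)) = ∑ i, shiftForm A α B (x i) := by
    intro α
    unfold shiftForm
    rw [Finset.sum_comm]
    refine Finset.sum_congr rfl fun β hβ => ?_
    split_ifs with hαβ
    · rw [opTensor_coe, UniformSpace.Completion.inner_coe, hf β hβ, hf _ hαβ, map_sum]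
      simp only [TensorProduct.mapL_tmul]
      exact inner_sum_tmul_orthonormal he _ _
    · simp
  have hnorm : ∀ β ∈ B, ‖(f β : HilbertTensor K E)‖ ^ 2 = ∑ i, ‖x i β‖ ^ 2 := by
    intro β hβ
    rw [UniformSpace.Completion.norm_coe, ← inner_self_eq_norm_sq (𝕜 := ℂ), hf β hβ,
      inner_sum_tmul_orthonormal he, map_sum]
    exact Finset.sum_congr rfl fun i _ => inner_self_eq_norm_sq _
  simp only [hform]
  rw [Finset.sum_congr rfl hnorm, Finset.sum_comm (s := B), Finset.mul_sum,
    Finset.sum_comm (s := degreeWords n q)]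
  exact (norm_sum_le _ _).trans (Finset.sum_le_sum fun i _ => h B (x i))

end

/-! ### The von Neumann type inequality for the numerical radius -/

section

variable {k : ℕ} {n : Fin k → ℕ}

/-- For a square summable family the compressed shift forms converge to the full series, by
dominated convergence; left multiplication by `α` is injective, so `‖g_β‖² + ‖g_{αβ}‖²` is
summable. -/
theorem tendsto_shiftForm_wordBox {G : Type*} [NormedAddCommGroup G] [InnerProductSpace ℂ G]
    (C : MultiWord n → (G →L[ℂ] G)) (α : MultiWord n) {g : MultiWord n → G}
    (hg : Summable fun β => ‖g β‖ ^ 2) :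
    Filter.Tendsto (fun N => shiftForm C α (wordBox n N) g) Filter.atTop
      (𝓝 (∑' β, inner ℂ (C α (g β)) (g (α * β)))) ∧
    Summable fun β => inner ℂ (C α (g β)) (g (α * β)) := by
  classical
  have hbound : Summable fun β => ‖C α‖ * (‖g β‖ ^ 2 + ‖g (α * β)‖ ^ 2) :=
    (hg.add (hg.comp_injective (mul_right_injective α))).mul_left _
  have hle : ∀ β, ‖(inner ℂ (C α (g β)) (g (α * β)) : ℂ)‖
      ≤ ‖C α‖ * (‖g β‖ ^ 2 + ‖g (α * β)‖ ^ 2) := by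
    intro β
    refine (norm_inner_le_norm _ _).trans ?_
    calc ‖C α (g β)‖ * ‖g (α * β)‖ ≤ (‖C α‖ * ‖g β‖) * ‖g (α * β)‖ := by
          gcongr; exact ContinuousLinearMap.le_opNorm _ _
      _ = ‖C α‖ * (‖g β‖ * ‖g (α * β)‖) := mul_assoc _ _ _
      _ ≤ _ := by
          gcongr
          nlinarith [sq_nonneg (‖g β‖ - ‖g (α * β)‖), sq_nonneg (‖g β‖), sq_nonneg ‖g (α * β)‖]
  refine ⟨?_, hbound.of_norm_bounded hle⟩
  have hmem : ∀ γ : MultiWord n, ∀ᶠ N in Filter.atTop, γ ∈ wordBox n N := fun γ =>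
    (tendsto_wordBox.eventually_ge_atTop {γ}).mono fun N h => by simpa using h
  have h := tendsto_tsum_of_dominated_convergence (𝓕 := Filter.atTop)
    (f := fun (N : ℕ) β => if β ∈ wordBox n N ∧ α * β ∈ wordBox n N then
      (inner ℂ (C α (g β)) (g (α * β)) : ℂ) else 0)
    (g := fun β => inner ℂ (C α (g β)) (g (α * β))) hbound
    (fun β => tendsto_nhds_of_eventually_eq <| by
      filter_upwards [hmem β, hmem (α * β)] with N h1 h2
      rw [if_pos ⟨h1, h2⟩])
    (Filter.Eventually.of_forall fun N β => by
      split_ifs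
      · exact hle β
      · rw [norm_zero]; positivity)
  refine h.congr fun N => ?_
  rw [tsum_eq_sum (s := wordBox n N) fun β hβ => if_neg fun h => hβ h.1]
  unfold shiftForm
  refine Finset.sum_congr rfl fun β hβ => ?_
  simp only [hβ, true_and]

variable {K E : Type*} [NormedAddCommGroup K] [InnerProductSpace ℂ K] [CompleteSpace K]
  [NormedAddCommGroup E] [InnerProductSpace ℂ E] [CompleteSpace E]

/-- A form bound controls the quadratic form of the homogeneous part at every point of the
polyball. Writing `Δ_X(I) = D^* D`, the vectors `h_β = (I ⊗ D X_β^*) h` are square summable with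
`∑ ‖h_β‖² = ‖h‖²` and intertwine `A_α ⊗ X_α` with the shift form of `A_α ⊗ I`. -/
theorem IsFormBound.norm_inner_homPart_le {A : MultiWord n → (K →L[ℂ] K)} {q : ℕ} {c : ℝ}
    (hc : IsFormBound A q c) {X : OpTuple n E} (hX : X ∈ polyball n E) (h : HilbertTensor K E) :
    ‖inner ℂ (homPart A q X h) h‖ ≤ c * ‖h‖ ^ 2 := by
  obtain ⟨D, hD⟩ := CStarAlgebra.nonneg_iff_eq_star_mul_self.1 hX.2.2.nonneg
  have hlim := tendsto_sum_wordBox_defect hX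
  set g : MultiWord n → HilbertTensor K E :=
    fun β => opTensor 1 (D * star (wordEval X β)) h with hg
  -- inner products of the vectors `h_β` in terms of the Poisson summands
  have hinner : ∀ (β : MultiWord n) (a : K →L[ℂ] K) (Y : E →L[ℂ] E),
      inner ℂ (opTensor a 1 (g β)) (opTensor 1 (D * star (Y * wordEval X β)) h) =
      inner ℂ (opTensor a (Y *
        (wordEval X β * defectMap X 1 * star (wordEval X β))) h) h := by
    intro β a Y
    have h1 : opTensor (1 : K →L[ℂ] K) (D * star (Y * wordEval X β)) =
        opTensor (star 1) (star (Y * wordEval X β * star D)) := by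
      simp [mul_assoc]
    rw [h1, ← inner_opTensor_left, hg]
    simp only [← mul_apply_eq_comp, ← opTensor_mul, hD]
    simp [mul_assoc]
  have hlimop : ∀ (a : K →L[ℂ] K) (Y : E →L[ℂ] E), Filter.Tendsto
      (fun N => ∑ β ∈ wordBox n N, inner ℂ (opTensor a (Y *
        (wordEval X β * defectMap X 1 * star (wordEval X β))) h) h) Filter.atTop
      (𝓝 (inner ℂ (opTensor a Y h) h)) := by
    intro a Y
    have hcont : Continuous fun Z : E →L[ℂ] E =>
        (inner ℂ (opTensorL (K := K) a (Y * Z) h) h : ℂ) := by fun_prop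
    have := (hcont.tendsto 1).comp hlim
    rw [mul_one] at this
    refine this.congr fun N => ?_
    simp only [Function.comp_apply, Finset.mul_sum, map_sum, sum_apply, sum_inner]
    rfl
  -- square summability and the Parseval identity for `h_β`
  have hsqlim : Filter.Tendsto (fun N => ∑ β ∈ wordBox n N, ‖g β‖ ^ 2) Filter.atTop
      (𝓝 (‖h‖ ^ 2)) := by
    have := (Complex.continuous_re.tendsto _).comp (hlimop 1 1)
    rw [opTensor_one_one] at this
    refine (this.congr fun N => ?_).trans_eq ?_
    · rw [Function.comp_apply, Complex.re_sum]
      refine Finset.sum_congr rfl fun β _ => ?_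
      rw [← inner_self_eq_norm_sq (𝕜 := ℂ)]
      have h2 := hinner β 1 1
      rw [opTensor_one_one, one_mul, one_apply_eq_self] at h2
      exact congrArg Complex.re h2.symm
    · rw [← inner_self_eq_norm_sq (𝕜 := ℂ)]
      rfl
  have hmono : Monotone fun N => ∑ β ∈ wordBox n N, ‖g β‖ ^ 2 := fun N M hNM =>
    Finset.sum_le_sum_of_subset_of_nonneg (wordBox_mono hNM) fun _ _ _ => by positivity
  have hsummable : Summable fun β => ‖g β‖ ^ 2 := by
    refine summable_of_sum_le (c := ‖h‖ ^ 2) (fun _ => by positivity) fun B => ?_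
    obtain ⟨N, hN⟩ := (tendsto_wordBox.eventually_ge_atTop B).exists
    exact (Finset.sum_le_sum_of_subset_of_nonneg hN fun _ _ _ => by positivity).trans
      (hmono.ge_of_tendsto hsqlim N)
  have hform : ∀ α, Filter.Tendsto
      (fun N => shiftForm (fun α => opTensor (A α) (1 : E →L[ℂ] E)) α (wordBox n N) g)
      Filter.atTop (𝓝 (inner ℂ (opTensor (A α) (wordEval X α) h) h)) := by
    intro α
    obtain ⟨h1, h2⟩ := tendsto_shiftForm_wordBox (fun α => opTensor (A α) (1 : E →L[ℂ] E)) α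
      hsummable
    have h3 := h2.hasSum.comp tendsto_wordBox
    have h4 := tendsto_nhds_unique h3 ((hlimop (A α) (wordEval X α)).congr fun N => by
      refine Finset.sum_congr rfl fun β _ => ?_
      rw [← hinner, ← wordEval_mul hX.2.1])
    rwa [h4] at h1
  have htot : Filter.Tendsto (fun N => ‖∑ α ∈ degreeWords n q,
      shiftForm (fun α => opTensor (A α) (1 : E →L[ℂ] E)) α (wordBox n N) g‖)
      Filter.atTop (𝓝 ‖inner ℂ (homPart A q X h) h‖) := by
    rw [homPart, sum_apply, sum_inner]
    exact (tendsto_finsetSum _ fun α _ => hform α).norm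
  exact le_of_tendsto_of_tendsto' htot (hsqlim.const_mul c) fun N =>
    hc.opTensor_one (wordBox n N) g

theorem continuous_wordEval {E : Type*} [NormedAddCommGroup E] [InnerProductSpace ℂ E]
    (α : MultiWord n) : Continuous fun X : OpTuple n E => wordEval X α := by
  unfold wordEval
  refine (ContinuousMultilinearMap.mkPiAlgebraFin ℂ k (E →L[ℂ] E)).cont.comp
    (continuous_pi fun i => ?_)
  generalize α i = w
  induction w using FreeMonoid.inductionOn' with
  | one => simpa using continuous_const
  | of_mul j w ih =>
    simp only [map_mul, FreeMonoid.lift_eval_of]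
    exact Continuous.mul (by fun_prop) ih

theorem continuous_homPart {K E : Type*} [NormedAddCommGroup K] [InnerProductSpace ℂ K]
    [NormedAddCommGroup E] [InnerProductSpace ℂ E] (A : MultiWord n → (K →L[ℂ] K)) (q : ℕ) :
    Continuous fun X : OpTuple n E => homPart A q X :=
  continuous_finsetSum _ fun α _ => (opTensorL (A α)).continuous.comp (continuous_wordEval α)

theorem wordEval_smul {E : Type*} [NormedAddCommGroup E] [InnerProductSpace ℂ E]
    (r : ℂ) (X : OpTuple n E) (α : MultiWord n) :
    wordEval (r • X) α = r ^ (∑ i, (α i).length) • wordEval X α := by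
  have hlift : ∀ i, FreeMonoid.lift ((r • X) i) (α i) =
      r ^ (α i).length • FreeMonoid.lift (X i) (α i) := by
    intro i
    generalize α i = w
    induction w using FreeMonoid.inductionOn' with
    | one => simp
    | of_mul j w ih =>
      rw [map_mul, map_mul, ih, FreeMonoid.lift_eval_of, FreeMonoid.lift_eval_of,
        FreeMonoid.length_mul, FreeMonoid.length_of, pow_add, pow_one, Pi.smul_apply,
        Pi.smul_apply, smul_mul_smul_comm]
  unfold wordEval
  simp only [hlift]
  rw [← Finset.prod_pow_eq_pow_sum]
  exact (MultilinearMap.mkPiAlgebraFin ℂ k (E →L[ℂ] E)).map_smul_univ _ _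

theorem mem_degreeWords {q : ℕ} {α : MultiWord n} :
    α ∈ degreeWords n q ↔ ∑ i, (α i).length = q := by
  simp [degreeWords]

theorem mem_multiDegreeWords {p : Fin k → ℕ} {α : MultiWord n} :
    α ∈ multiDegreeWords n p ↔ ∀ i, (α i).length = p i := by
  simp [multiDegreeWords]

theorem homPart_smul {K E : Type*} [NormedAddCommGroup K] [InnerProductSpace ℂ K]
    [NormedAddCommGroup E] [InnerProductSpace ℂ E] (A : MultiWord n → (K →L[ℂ] K)) (q : ℕ)
    (r : ℂ) (X : OpTuple n E) :
    homPart A q (r • X) = r ^ q • homPart A q X := by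
  unfold homPart
  rw [Finset.smul_sum]
  refine Finset.sum_congr rfl fun α hα => ?_
  rw [wordEval_smul, mem_degreeWords.1 hα, ← opTensorL_apply, map_smul, opTensorL_apply]

theorem IsFormBound.norm_inner_homPart_le_of_mem_closure {A : MultiWord n → (K →L[ℂ] K)} {q : ℕ}
    {c : ℝ} (hc : IsFormBound A q c) {X : OpTuple n E} (hX : X ∈ closure (polyball n E))
    (h : HilbertTensor K E) : ‖inner ℂ (homPart A q X h) h‖ ≤ c * ‖h‖ ^ 2 := by
  refine closure_minimal (s := polyball n E)
    (t := {X | ‖inner ℂ (homPart A q X h) h‖ ≤ c * ‖h‖ ^ 2})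
    (fun X hX => hc.norm_inner_homPart_le hX h) (isClosed_le ?_ continuous_const) hX
  have := continuous_homPart (E := E) A q
  fun_prop

end

/-! ### Doubly commuting tuples -/

section

variable {E : Type*} [NormedAddCommGroup E] [InnerProductSpace ℂ E] [CompleteSpace E]

theorem defectMap_one_of_doublyCommuting {k : ℕ} {n : Fin k → ℕ} (X : OpTuple n E)
    (hstar : ∀ s t, s ≠ t → ∀ a b, Commute (X s a) (star (X t b)))
    (hcomm : ∀ s t, s ≠ t → ∀ a b, Commute (X s a) (X t b)) :
    defectMap X 1 = (List.ofFn fun i => 1 - ∑ j, X i j * star (X i j)).prod := by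
  induction k with
  | zero => simp [defectMap]
  | succ k ih =>
    have hne : ∀ {s t : Fin k}, s ≠ t → s.succ ≠ t.succ := fun h e => h (Fin.succ_injective _ e)
    have h := ih (n := fun i => n i.succ) (fun i => X i.succ)
      (fun s t hst => hstar _ _ (hne hst)) (fun s t hst => hcomm _ _ (hne hst))
    unfold defectMap at h ⊢
    rw [List.ofFn_succ, List.prod_cons, List.ofFn_succ, List.prod_cons, Module.End.mul_apply, h]
    set Z := (List.ofFn fun i : Fin k => 1 - ∑ j, X i.succ j * star (X i.succ j)).prod
    have hZ : ∀ j, Commute (star (X 0 j)) Z := by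
      intro j
      refine Commute.list_prod_right _ _ fun y hy => ?_
      obtain ⟨i, rfl⟩ := List.mem_ofFn.1 hy
      refine (Commute.one_right _).sub_right (Commute.sum_right _ _ _ fun a _ => ?_)
      exact (hstar _ _ (Fin.succ_ne_zero i) a j).symm.mul_right
        (hcomm _ _ (Fin.succ_ne_zero i).symm j a).star_star
    rw [LinearMap.sub_apply, Module.End.one_apply, rowMap_apply, sub_mul, one_mul, Finset.sum_mul]
    congr 1
    refine Finset.sum_congr rfl fun j _ => ?_
    rw [mul_assoc, mul_assoc, (hZ j).eq]

theorem isStrictlyPositive_list_prod_ofFn {k : ℕ} (a : Fin k → (E →L[ℂ] E))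
    (ha : ∀ i, IsStrictlyPositive (a i)) (hcomm : ∀ i j, Commute (a i) (a j)) :
    IsStrictlyPositive (List.ofFn a).prod := by
  induction k with
  | zero => simp
  | succ k ih =>
    have h := ih (fun i => a i.succ) (fun i => ha _) (fun i j => hcomm _ _)
    have hc : Commute (a 0) (List.ofFn fun i : Fin k => a i.succ).prod := by
      refine Commute.list_prod_right _ _ fun x hx => ?_
      obtain ⟨i, rfl⟩ := List.mem_ofFn.1 hx
      exact hcomm _ _
    rw [List.ofFn_succ, List.prod_cons]
    exact ((ha 0).isUnit.mul h.isUnit).isStrictlyPositive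
      (Commute.mul_nonneg (ha 0).nonneg h.nonneg hc)

variable {k : ℕ} {n : Fin k → ℕ}

/-- Doubly commuting strict row contractions lie in the polyball, since the defect operator is then
the product of the commuting operators `I - ∑_j X_{i,j} X_{i,j}^*`. -/
theorem mem_polyball_of_doublyCommuting {X : OpTuple n E}
    (hrow : ∀ i, ‖∑ j, X i j * star (X i j)‖ < 1)
    (hstar : ∀ s t, s ≠ t → ∀ a b, Commute (X s a) (star (X t b)))
    (hcomm : ∀ s t, s ≠ t → ∀ a b, Commute (X s a) (X t b)) : X ∈ polyball n E := by
  refine ⟨hrow, hcomm, ?_⟩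
  rw [defectMap_one_of_doublyCommuting X hstar hcomm]
  refine isStrictlyPositive_list_prod_ofFn _ (fun i => ?_) fun i l => ?_
  · have hQ : 0 ≤ ∑ j, X i j * star (X i j) :=
      Finset.sum_nonneg fun j _ => mul_star_self_nonneg _
    refine (isUnit_one_sub_of_norm_lt_one (hrow i)).isStrictlyPositive ?_
    rw [sub_nonneg]
    exact (CStarAlgebra.norm_le_one_iff_of_nonneg _ hQ).1 (hrow i).le
  · rcases eq_or_ne i l with rfl | hil
    · exact Commute.refl _
    · refine (Commute.one_right _).sub_right (Commute.sub_left (Commute.one_left _) ?_)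
      refine Commute.sum_left _ _ _ fun a _ => Commute.sum_right _ _ _ fun b _ => ?_
      exact ((hcomm _ _ hil a b).mul_right (hstar _ _ hil a b)).mul_left
        ((hstar _ _ hil.symm b a).symm.mul_right (hcomm _ _ hil a b).star_star)

theorem smul_mem_polyball_of_doublyCommuting {X : OpTuple n E}
    (hrow : ∀ i, ‖∑ j, X i j * star (X i j)‖ ≤ 1)
    (hstar : ∀ s t, s ≠ t → ∀ a b, Commute (X s a) (star (X t b)))
    (hcomm : ∀ s t, s ≠ t → ∀ a b, Commute (X s a) (X t b)) {r : ℝ} (h0 : 0 ≤ r) (h1 : r < 1) :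
    (r : ℂ) • X ∈ polyball n E := by
  refine mem_polyball_of_doublyCommuting (fun i => ?_) (fun s t hst a b => ?_)
    fun s t hst a b => ?_
  · have : ∑ j, ((r : ℂ) • X) i j * star (((r : ℂ) • X) i j) =
        ((r ^ 2 : ℝ) : ℂ) • ∑ j, X i j * star (X i j) := by
      rw [Finset.smul_sum]
      refine Finset.sum_congr rfl fun j _ => ?_
      simp only [Pi.smul_apply, star_smul, smul_mul_smul_comm]
      congr 1
      simp [pow_two]
    rw [this, norm_smul, Complex.norm_real, Real.norm_of_nonneg (by positivity)]
    calc r ^ 2 * _ ≤ r ^ 2 * 1 := by gcongr; exact hrow i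
      _ < 1 := by nlinarith
  · simp only [Pi.smul_apply, star_smul]
    exact ((hstar s t hst a b).smul_left (r : ℂ)).smul_right (star (r : ℂ))
  · exact ((hcomm s t hst a b).smul_left (r : ℂ)).smul_right (r : ℂ)

theorem mem_closure_polyball_of_doublyCommuting {X : OpTuple n E}
    (hrow : ∀ i, ‖∑ j, X i j * star (X i j)‖ ≤ 1)
    (hstar : ∀ s t, s ≠ t → ∀ a b, Commute (X s a) (star (X t b)))
    (hcomm : ∀ s t, s ≠ t → ∀ a b, Commute (X s a) (X t b)) : X ∈ closure (polyball n E) := by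
  have hlim : Filter.Tendsto (fun r : ℝ => (r : ℂ) • X) (𝓝[<] 1) (𝓝 X) := by
    have : Continuous fun r : ℝ => (r : ℂ) • X := by fun_prop
    simpa using (this.tendsto 1).mono_left nhdsWithin_le_nhds
  refine mem_closure_of_tendsto hlim ?_
  filter_upwards [self_mem_nhdsWithin, mem_nhdsWithin_of_mem_nhds (Ioi_mem_nhds zero_lt_one)]
    with r h1 h0
  exact smul_mem_polyball_of_doublyCommuting hrow hstar hcomm (le_of_lt h0) h1

end

/-! ### The universal model and its copies on other spaces -/

section

variable {k : ℕ} {n : Fin k → ℕ}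

theorem fockSpace_ext {F : Type*} [NormedAddCommGroup F] [InnerProductSpace ℂ F]
    {S T : FockSpace n →L[ℂ] F} (h : ∀ β, S (fockBasis n β) = T (fockBasis n β)) : S = T := by
  classical
  refine ContinuousLinearMap.ext fun x => ?_
  have hx := lp.hasSum_single (p := 2) (by norm_num) x
  have hs : ∀ β, lp.single 2 β (x β) = x β • fockBasis n β := by
    intro β
    have : fockBasis n β = lp.single 2 β 1 := by unfold fockBasis; congr
    rw [this, ← lp.single_smul]
    simp
  simp only [hs] at hx
  have h1 := hx.mapL S
  have h2 := hx.mapL T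
  simp only [map_smul, h] at h1 h2
  exact h1.unique h2

theorem eq_zero_of_inner_fockBasis {x : FockSpace n} (h : ∀ β, inner ℂ (fockBasis n β) x = 0) :
    x = 0 := by
  classical
  ext β
  have := h β
  unfold fockBasis at this
  rw [lp.inner_single_left] at this
  simpa using this

theorem star_universalModel_mul_self (i : Fin k) (j : Fin (n i)) :
    star (universalModel n i j) * universalModel n i j = 1 := by
  refine ContinuousLinearMap.ext fun x => ext_inner_right ℂ fun y => ?_
  rw [mul_apply_eq_comp, ContinuousLinearMap.star_eq_adjoint,
    ContinuousLinearMap.adjoint_inner_left]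
  exact LinearIsometry.inner_map_map _ _ _

theorem star_universalModel_apply_of_notMem {i : Fin k} {j : Fin (n i)} {β : MultiWord n}
    (h : ∀ δ, leftMul i j δ ≠ β) : star (universalModel n i j) (fockBasis n β) = 0 := by
  refine eq_zero_of_inner_fockBasis fun γ => ?_
  rw [ContinuousLinearMap.star_eq_adjoint, ContinuousLinearMap.adjoint_inner_right,
    universalModel_apply_basis]
  exact (orthonormal_fockBasis n).2 (h γ)

theorem star_universalModel_mul_of_ne (i : Fin k) {a b : Fin (n i)} (hab : a ≠ b) :
    star (universalModel n i a) * universalModel n i b = 0 := by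
  refine fockSpace_ext fun β => ?_
  rw [mul_apply_eq_comp, universalModel_apply_basis, star_universalModel_apply_of_notMem]
  · rfl
  · intro δ h
    have := congrFun h i
    simp only [leftMul, Function.update_self] at this
    exact hab (List.cons.inj
      (show a :: FreeMonoid.toList (δ i) = b :: FreeMonoid.toList (β i) from this)).1

theorem leftMul_comm {s t : Fin k} (hst : s ≠ t) (a : Fin (n s)) (b : Fin (n t))
    (β : MultiWord n) : leftMul s a (leftMul t b β) = leftMul t b (leftMul s a β) := by
  unfold leftMul
  rw [Function.update_of_ne hst, Function.update_of_ne hst.symm, Function.update_comm hst]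

theorem commute_universalModel (s t : Fin k) (hst : s ≠ t) (a : Fin (n s)) (b : Fin (n t)) :
    Commute (universalModel n s a) (universalModel n t b) := by
  refine fockSpace_ext fun β => ?_
  rw [mul_apply_eq_comp, mul_apply_eq_comp]
  simp only [universalModel_apply_basis, leftMul_comm hst]

theorem commute_universalModel_star (s t : Fin k) (hst : s ≠ t) (a : Fin (n s)) (b : Fin (n t)) :
    Commute (universalModel n s a) (star (universalModel n t b)) := by
  refine fockSpace_ext fun β => ?_
  rw [mul_apply_eq_comp, mul_apply_eq_comp]
  have hinv : ∀ δ, star (universalModel n t b) (fockBasis n (leftMul t b δ)) = fockBasis n δ := by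
    intro δ
    rw [← universalModel_apply_basis, ← mul_apply_eq_comp, star_universalModel_mul_self]
    rfl
  by_cases h : ∃ δ, leftMul t b δ = β
  · obtain ⟨δ, rfl⟩ := h
    rw [hinv, universalModel_apply_basis, universalModel_apply_basis, leftMul_comm hst, hinv]
  · push Not at h
    rw [star_universalModel_apply_of_notMem h, map_zero, universalModel_apply_basis,
      star_universalModel_apply_of_notMem]
    intro δ hδ
    -- the `t`-th component of `β` begins with the letter `b`, hence `β` is in the range
    refine h (Function.update δ s (β s)) ?_
    funext l
    have hl := congrFun hδ l
    by_cases hlt : l = t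
    · subst hlt
      simpa [leftMul, hst.symm] using hl
    · by_cases hls : l = s
      · subst hls
        simp [leftMul, hlt]
      · simpa [leftMul, hlt, hls] using hl

theorem norm_sum_universalModel_le (i : Fin k) :
    ‖∑ j, universalModel n i j * star (universalModel n i j)‖ ≤ 1 := by
  set Q := ∑ j, universalModel n i j * star (universalModel n i j) with hQ
  have hstar : star Q = Q := by simp [hQ]
  have hidem : Q * Q = Q := by
    rw [hQ, Finset.sum_mul_sum]
    refine Finset.sum_congr rfl fun a _ => ?_
    rw [Finset.sum_eq_single a]
    · rw [mul_assoc, ← mul_assoc (star (universalModel n i a)), star_universalModel_mul_self,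
        one_mul]
    · intro b _ hb
      rw [mul_assoc, ← mul_assoc (star (universalModel n i a)),
        star_universalModel_mul_of_ne i hb.symm, zero_mul, mul_zero]
    · simp
  have h := CStarRing.norm_star_mul_self (x := Q)
  rw [hstar, hidem] at h
  nlinarith [norm_nonneg Q]

variable {E : Type*} [NormedAddCommGroup E] [InnerProductSpace ℂ E] [CompleteSpace E]

/-- The copy `V T V^*` on `E` of an operator `T` on the Fock space, for an isometry `V`. -/
noncomputable def transport (V : FockSpace n →ₗᵢ[ℂ] E) (T : FockSpace n →L[ℂ] FockSpace n) :
    E →L[ℂ] E :=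
  V.toContinuousLinearMap ∘L T ∘L ContinuousLinearMap.adjoint V.toContinuousLinearMap

variable (V : FockSpace n →ₗᵢ[ℂ] E)

theorem adjoint_apply_isometry (x : FockSpace n) :
    ContinuousLinearMap.adjoint V.toContinuousLinearMap (V x) = x := by
  refine ext_inner_right ℂ fun y => ?_
  rw [ContinuousLinearMap.adjoint_inner_left]
  exact V.inner_map_map x y

theorem transport_apply_isometry (T : FockSpace n →L[ℂ] FockSpace n) (x : FockSpace n) :
    transport V T (V x) = V (T x) := by
  simp [transport, adjoint_apply_isometry]

theorem transport_mul (T T' : FockSpace n →L[ℂ] FockSpace n) :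
    transport V (T * T') = transport V T * transport V T' := by
  refine ContinuousLinearMap.ext fun x => ?_
  simp [transport, adjoint_apply_isometry]

theorem star_transport (T : FockSpace n →L[ℂ] FockSpace n) :
    star (transport V T) = transport V (star T) := by
  simp only [transport, ContinuousLinearMap.star_eq_adjoint, ContinuousLinearMap.adjoint_comp,
    ContinuousLinearMap.adjoint_adjoint, ContinuousLinearMap.comp_assoc]

theorem norm_transport_le (T : FockSpace n →L[ℂ] FockSpace n) : ‖transport V T‖ ≤ ‖T‖ := by
  have h1 : ‖V.toContinuousLinearMap‖ ≤ 1 := V.norm_toContinuousLinearMap_le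
  have h2 : ‖ContinuousLinearMap.adjoint V.toContinuousLinearMap‖ ≤ 1 := by
    rwa [LinearIsometryEquiv.norm_map]
  calc ‖transport V T‖ ≤ ‖V.toContinuousLinearMap‖ *
        (‖T‖ * ‖ContinuousLinearMap.adjoint V.toContinuousLinearMap‖) :=
        (ContinuousLinearMap.opNorm_comp_le _ _).trans
          (mul_le_mul_of_nonneg_left (ContinuousLinearMap.opNorm_comp_le _ _) (norm_nonneg _))
    _ ≤ 1 * (‖T‖ * 1) := by gcongr
    _ = ‖T‖ := by ring

theorem commute_transport {T T' : FockSpace n →L[ℂ] FockSpace n} (h : Commute T T') :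
    Commute (transport V T) (transport V T') := by
  rw [commute_iff_eq, ← transport_mul, ← transport_mul, h.eq]

/-- The copy on `E` of the universal model. -/
noncomputable def modelCopy : OpTuple n E := fun i j => transport V (universalModel n i j)

theorem norm_sum_modelCopy_le (i : Fin k) :
    ‖∑ j, modelCopy V i j * star (modelCopy V i j)‖ ≤ 1 := by
  have : ∑ j, modelCopy V i j * star (modelCopy V i j) =
      transport V (∑ j, universalModel n i j * star (universalModel n i j)) := by
    simp only [modelCopy, star_transport, ← transport_mul]
    refine ContinuousLinearMap.ext fun x => ?_
    simp [transport]
  rw [this]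
  exact (norm_transport_le V _).trans (norm_sum_universalModel_le i)

theorem modelCopy_mem_closure : modelCopy V ∈ closure (polyball n E) :=
  mem_closure_polyball_of_doublyCommuting (norm_sum_modelCopy_le V)
    (fun s t hst a b => by
      rw [modelCopy, modelCopy, star_transport]
      exact commute_transport V (commute_universalModel_star s t hst a b))
    fun s t hst a b => commute_transport V (commute_universalModel s t hst a b)

theorem universalModel_mem_closure : universalModel n ∈ closure (polyball n (FockSpace n)) :=
  mem_closure_polyball_of_doublyCommuting norm_sum_universalModel_le commute_universalModel_star
    commute_universalModel

theorem smul_universalModel_mem {r : ℝ} (h0 : 0 ≤ r) (h1 : r < 1) :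
    (r : ℂ) • universalModel n ∈ polyball n (FockSpace n) :=
  smul_mem_polyball_of_doublyCommuting norm_sum_universalModel_le commute_universalModel_star
    commute_universalModel h0 h1

/-! ### Shift forms as quadratic forms of the homogeneous parts -/

omit [CompleteSpace E] in
theorem wordEval_apply_of_shift {X : OpTuple n E} {f : MultiWord n → E}
    (h : ∀ i j β, X i j (f β) = f (leftMul i j β)) (α β : MultiWord n) :
    wordEval X α (f β) = f (α * β) := by
  have hleft : ∀ i (j : Fin (n i)) (β : MultiWord n),
      leftMul i j β = Pi.mulSingle i (FreeMonoid.of j) * β := by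
    intro i j β
    funext l
    by_cases hl : l = i
    · subst hl; simp [leftMul]
    · simp [leftMul, hl]
  have hlift : ∀ i (w : FreeMonoid (Fin (n i))) (β : MultiWord n),
      FreeMonoid.lift (X i) w (f β) = f (Pi.mulSingle i w * β) := by
    intro i w
    induction w using FreeMonoid.inductionOn' with
    | one => intro β; simp
    | of_mul j w ih =>
      intro β
      rw [map_mul, mul_apply_eq_comp, ih, FreeMonoid.lift_eval_of, h, hleft, Pi.mulSingle_mul,
        mul_assoc]
  have hlist : ∀ {l : ℕ} (T : Fin l → (E →L[ℂ] E)) (g : Fin l → MultiWord n),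
      (∀ i β, T i (f β) = f (g i * β)) → ∀ β,
      (List.ofFn T).prod (f β) = f ((List.ofFn g).prod * β) := by
    intro l
    induction l with
    | zero => intro T g _ β; simp
    | succ l ih =>
      intro T g hT β
      rw [List.ofFn_succ, List.prod_cons, List.ofFn_succ, List.prod_cons, mul_apply_eq_comp,
        ih _ _ (fun i => hT i.succ), hT, mul_assoc]
  rw [wordEval, hlist _ _ (fun i => hlift i (α i)), list_prod_ofFn_mulSingle]

variable {K : Type*} [NormedAddCommGroup K] [InnerProductSpace ℂ K]

/-- The vector `∑_{β ∈ B} g_β ⊗ f_β`. -/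
noncomputable def tensorVector (f : MultiWord n → E) (B : Finset (MultiWord n))
    (g : MultiWord n → K) : HilbertTensor K E :=
  ((∑ β ∈ B, g β ⊗ₜ[ℂ] f β : K ⊗[ℂ] E) : HilbertTensor K E)

omit [CompleteSpace E] in
theorem norm_tensorVector_sq {f : MultiWord n → E} (hf : Orthonormal ℂ f)
    (B : Finset (MultiWord n)) (g : MultiWord n → K) :
    ‖tensorVector f B g‖ ^ 2 = ∑ β ∈ B, ‖g β‖ ^ 2 := by
  classical
  rw [tensorVector, UniformSpace.Completion.norm_coe, ← inner_self_eq_norm_sq (𝕜 := ℂ), sum_inner,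
    map_sum]
  refine Finset.sum_congr rfl fun β hβ => ?_
  rw [inner_sum, Finset.sum_eq_single β]
  · rw [TensorProduct.inner_tmul, orthonormal_iff_ite.1 hf, if_pos rfl, mul_one]
    exact inner_self_eq_norm_sq _
  · intro γ _ hγ
    rw [TensorProduct.inner_tmul, orthonormal_iff_ite.1 hf, if_neg hγ.symm, mul_zero]
  · exact fun h => absurd hβ h

omit [CompleteSpace E] in
theorem inner_opTensor_tensorVector {f : MultiWord n → E} (hf : Orthonormal ℂ f)
    (A : MultiWord n → (K →L[ℂ] K)) {T : E →L[ℂ] E} {α : MultiWord n} {c : ℝ}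
    (hT : ∀ β, T (f β) = (c : ℂ) • f (α * β)) (B : Finset (MultiWord n)) (g : MultiWord n → K) :
    inner ℂ (opTensor (A α) T (tensorVector f B g)) (tensorVector f B g) =
      c * shiftForm A α B g := by
  classical
  rw [tensorVector, opTensor_coe, UniformSpace.Completion.inner_coe, map_sum, sum_inner,
    shiftForm, Finset.mul_sum]
  refine Finset.sum_congr rfl fun β _ => ?_
  rw [TensorProduct.mapL_tmul, inner_sum, hT]
  simp only [TensorProduct.inner_tmul, inner_smul_left, orthonormal_iff_ite.1 hf,
    Complex.conj_ofReal]
  split_ifs with h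
  · rw [Finset.sum_eq_single (α * β)]
    · simp [mul_comm]
    · intro γ _ hγ
      simp [hγ.symm]
    · exact fun h' => absurd h h'
  · rw [mul_zero]
    refine Finset.sum_eq_zero fun γ hγ => ?_
    rw [if_neg (fun e : α * β = γ => h (e ▸ hγ))]
    simp

omit [CompleteSpace E] in
/-- An orthonormal family on which `X` acts as the universal model acts on its basis makes the
shift form a compression of the homogeneous part at `X`. -/
theorem isFormBound_of_shift {X : OpTuple n E} {f : MultiWord n → E} (hf : Orthonormal ℂ f)
    (h : ∀ i j β, X i j (f β) = f (leftMul i j β)) {A : MultiWord n → (K →L[ℂ] K)} {q : ℕ} :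
    IsFormBound A q (numericalRadius (homPart A q X)) := by
  intro B g
  have h1 := norm_inner_le_numericalRadius (homPart A q X) (tensorVector f B g)
  rw [norm_tensorVector_sq hf, homPart, sum_apply, sum_inner] at h1
  refine le_of_eq_of_le ?_ h1
  congr 1
  refine Finset.sum_congr rfl fun α _ => ?_
  rw [inner_opTensor_tensorVector hf A (c := 1), Complex.ofReal_one, one_mul]
  intro β
  rw [wordEval_apply_of_shift h]
  simp

theorem isFormBound_universalModel (A : MultiWord n → (K →L[ℂ] K)) (q : ℕ) :
    IsFormBound A q (numericalRadius (homPart A q (universalModel n))) :=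
  isFormBound_of_shift (orthonormal_fockBasis n) (universalModel_apply_basis n)

theorem isFormBound_modelCopy (A : MultiWord n → (K →L[ℂ] K)) (q : ℕ) :
    IsFormBound A q (numericalRadius (homPart A q (modelCopy V))) := by
  refine isFormBound_of_shift ((orthonormal_fockBasis n).comp_linearIsometry V) fun i j β => ?_
  rw [Function.comp_apply, modelCopy, transport_apply_isometry, universalModel_apply_basis]
  rfl

variable [CompleteSpace K]

theorem IsFormBound.numericalRadius_homPart_le {A : MultiWord n → (K →L[ℂ] K)} {q : ℕ} {c : ℝ}
    (h0 : 0 ≤ c) (hc : IsFormBound A q c) {X : OpTuple n E} (hX : X ∈ closure (polyball n E)) :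
    numericalRadius (homPart A q X) ≤ c :=
  numericalRadius_le h0 (hc.norm_inner_homPart_le_of_mem_closure hX)

theorem numericalRadius_homPart_le_universalModel (A : MultiWord n → (K →L[ℂ] K)) (q : ℕ)
    {X : OpTuple n E} (hX : X ∈ closure (polyball n E)) :
    numericalRadius (homPart A q X) ≤ numericalRadius (homPart A q (universalModel n)) :=
  (isFormBound_universalModel A q).numericalRadius_homPart_le (numericalRadius_nonneg _) hX

theorem numericalRadius_homPart_modelCopy (A : MultiWord n → (K →L[ℂ] K)) (q : ℕ) :
    numericalRadius (homPart A q (modelCopy V)) =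
      numericalRadius (homPart A q (universalModel n)) :=
  le_antisymm (numericalRadius_homPart_le_universalModel A q (modelCopy_mem_closure V))
    ((isFormBound_modelCopy V A q).numericalRadius_homPart_le (numericalRadius_nonneg _)
      universalModel_mem_closure)

end

/-! ### Fejér's coefficient inequality -/

/-- Among the odd multiples of `π/M`, none is closer to `2πℤ` than `π/M` itself. -/
theorem cos_odd_mul_le (M : ℕ) (hM : 1 ≤ M) (t : ℕ) :
    Real.cos ((2 * t + 1) * (Real.pi / M)) ≤ Real.cos (Real.pi / M) := by
  have hM0 : (0 : ℝ) < M := by exact_mod_cast hM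
  have hpi := Real.pi_pos
  obtain ⟨a, b, hb, rfl⟩ : ∃ a b, b < M ∧ t = M * a + b :=
    ⟨t / M, t % M, Nat.mod_lt _ hM, (Nat.div_add_mod t M).symm⟩
  have h1 : (2 * ((M * a + b : ℕ) : ℝ) + 1) * (Real.pi / M) =
      (2 * b + 1) * (Real.pi / M) + a * (2 * Real.pi) := by
    push_cast
    field_simp
    ring
  rw [h1, Real.cos_add_nat_mul_two_pi]
  have hc : 0 < Real.pi / M := by positivity
  have hMc : M * (Real.pi / M) = Real.pi := by field_simp
  have hb' : (b : ℝ) + 1 ≤ M := by exact_mod_cast hb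
  rcases le_total ((2 * b + 1) * (Real.pi / M)) Real.pi with h | h
  · refine Real.cos_le_cos_of_nonneg_of_le_pi hc.le h ?_
    nlinarith [(Nat.cast_nonneg b : (0 : ℝ) ≤ b)]
  · rw [← Real.cos_two_pi_sub]
    refine Real.cos_le_cos_of_nonneg_of_le_pi hc.le (by linarith) ?_
    nlinarith

theorem sum_exp_equidistributed {T : ℕ} (hT : 1 ≤ T) {j : ℤ} (hj : ¬ (T : ℤ) ∣ j) (ψ : ℝ) :
    ∑ t ∈ Finset.range T, Complex.exp (j * (ψ + 2 * Real.pi * t / T) * Complex.I) = 0 := by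
  have hT0 : (T : ℂ) ≠ 0 := by exact_mod_cast (by omega : T ≠ 0)
  set x : ℂ := Complex.exp (2 * Real.pi * Complex.I / T) ^ j with hx
  have hprim : IsPrimitiveRoot (Complex.exp (2 * Real.pi * Complex.I / T)) T :=
    Complex.isPrimitiveRoot_exp T (by omega)
  have hx1 : x ≠ 1 := fun h => hj ((hprim.zpow_eq_one_iff_dvd j).1 h)
  have hxT : x ^ T = 1 := by
    rw [hx, ← zpow_natCast, ← zpow_mul, mul_comm j, zpow_mul, zpow_natCast, hprim.pow_eq_one,
      one_zpow]
  have hterm : ∀ t ∈ Finset.range T, Complex.exp (j * (ψ + 2 * Real.pi * t / T) * Complex.I) =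
      Complex.exp (j * ψ * Complex.I) * x ^ t := by
    intro t _
    rw [hx, ← Complex.exp_int_mul, ← Complex.exp_nat_mul, ← Complex.exp_add]
    congr 1
    field_simp
  rw [Finset.sum_congr rfl hterm, ← Finset.mul_sum]
  have h := geom_sum_mul_neg x T
  rw [hxT, sub_self] at h
  rw [(mul_eq_zero.1 h).resolve_right (sub_ne_zero.2 hx1.symm), mul_zero]

/-- Fejér's inequality for a nonnegative trigonometric polynomial
`b - Re ∑_{1 ≤ p ≤ L} D_p e^{ipθ}`. It is averaged against the nonnegative weights
`2 cos (π/M) + 2 cos (qψ)`, `M = N + 2`, over the `qM` angles `ψ` with `e^{iqMψ} = (-1)^{M+1}`;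
these weights single out the coefficients of order `0` and `q`. -/
theorem norm_coeff_le_of_trigPolynomial_nonneg {L q N : ℕ} (hq : 1 ≤ q) (hqL : q ≤ L)
    (hL : L < q * (N + 1)) (b : ℝ) (D : ℕ → ℂ)
    (h : ∀ θ : ℝ, (∑ p ∈ Finset.Icc 1 L, Complex.exp (p * θ * Complex.I) * D p).re ≤ b) :
    ‖D q‖ ≤ 2 * Real.cos (Real.pi / (N + 2)) * b := by
  have hq0 : (q : ℝ) ≠ 0 := by exact_mod_cast (by omega : q ≠ 0)
  set M : ℕ := N + 2 with hM
  have hMr : (M : ℝ) = N + 2 := by simp [hM]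
  have hM0 : (M : ℝ) ≠ 0 := by rw [hMr]; positivity
  set T : ℕ := q * M with hT
  have hT1 : 1 ≤ T := Nat.mul_pos hq (by omega)
  have hT0 : (0 : ℝ) < T := by exact_mod_cast hT1
  have hbig : L + q < T := by rw [hT, hM]; linarith [mul_add q N 1, mul_add q N 2]
  set c : ℝ := Real.cos (Real.pi / M) with hc
  set ψ₀ : ℝ := (Real.pi + Real.pi / M) / q with hψ₀
  set ψ : ℕ → ℝ := fun t => ψ₀ + 2 * Real.pi * t / T with hψ
  set w : ℕ → ℝ := fun t => 2 * c + 2 * Real.cos (q * ψ t) with hw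
  have hwnn : ∀ t, 0 ≤ w t := by
    intro t
    have h1 : q * ψ t = (2 * t + 1) * (Real.pi / M) + Real.pi := by
      simp only [hψ, hψ₀, hT]
      push_cast
      field_simp
      ring
    simp only [hw, h1, Real.cos_add_pi]
    linarith [cos_odd_mul_le M (by omega) t]
  -- the exponential sums `e j`
  set e : ℤ → ℂ := fun j => ∑ t ∈ Finset.range T, Complex.exp (j * ψ t * Complex.I) with he
  have he0 : e 0 = T := by simp [he]
  have hez : ∀ j : ℤ, j ≠ 0 → |j| < T → e j = 0 := by
    intro j hj0 hjT
    have := sum_exp_equidistributed hT1 (j := j)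
      (fun hd => hj0 (Int.eq_zero_of_abs_lt_dvd hd hjT)) ψ₀
    rw [← this]
    refine Finset.sum_congr rfl fun t _ => ?_
    simp only [hψ]
    push_cast
    rfl
  have hW : ∀ p : ℕ, ∑ t ∈ Finset.range T, (w t : ℂ) * Complex.exp (p * ψ t * Complex.I) =
      2 * c * e p + e (p + q) + e (p - q) := by
    intro p
    simp only [he, Finset.mul_sum, ← Finset.sum_add_distrib]
    refine Finset.sum_congr rfl fun t _ => ?_
    have h2 : ((2 * Real.cos (q * ψ t) : ℝ) : ℂ) =
        Complex.exp (q * ψ t * Complex.I) + Complex.exp (-(q * ψ t) * Complex.I) := by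
      push_cast
      rw [Complex.two_cos]
    simp only [hw]
    rw [Complex.ofReal_add, h2, add_mul, add_mul, ← Complex.exp_add, ← Complex.exp_add]
    push_cast
    rw [add_assoc]
    congr 2
    · congr 1; ring
    · congr 1; ring
  have hW0 : ∑ t ∈ Finset.range T, w t = 2 * c * T := by
    have h3 := hW 0
    simp only [Nat.cast_zero] at h3
    rw [hez (0 + q) (by omega) (by rw [abs_lt]; omega),
      hez (0 - q) (by omega) (by rw [abs_lt]; omega), he0] at h3
    have : ((∑ t ∈ Finset.range T, w t : ℝ) : ℂ) = ((2 * c * T : ℝ) : ℂ) := by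
      push_cast
      simpa using h3
    exact_mod_cast this
  have hWq : ∑ t ∈ Finset.range T, (w t : ℂ) * Complex.exp (q * ψ t * Complex.I) = T := by
    rw [hW q, hez q (by omega) (by rw [abs_lt]; omega),
      hez (q + q) (by omega) (by rw [abs_lt]; omega), sub_self, he0]
    simp
  have hWp : ∀ p ∈ Finset.Icc 1 L, p ≠ q →
      ∑ t ∈ Finset.range T, (w t : ℂ) * Complex.exp (p * ψ t * Complex.I) = 0 := by
    intro p hp hpq
    rw [Finset.mem_Icc] at hp
    rw [hW p, hez p (by omega) (by rw [abs_lt]; omega),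
      hez (p + q) (by omega) (by rw [abs_lt]; omega),
      hez (p - q) (by omega) (by rw [abs_lt]; omega)]
    simp
  -- a rotation making the coefficient of order `q` nonnegative
  set η : ℝ := -Complex.arg (D q) / q with hη
  have hrot : Complex.exp (q * η * Complex.I) * D q = ‖D q‖ := by
    have h4 : (q * η * Complex.I : ℂ) = -(Complex.arg (D q) * Complex.I) := by
      have : (q : ℝ) * η = -Complex.arg (D q) := by rw [hη]; field_simp
      rw [← Complex.ofReal_natCast, ← Complex.ofReal_mul, this]
      push_cast
      ring
    rw [h4]
    conv_lhs => rw [← Complex.norm_mul_exp_arg_mul_I (D q)]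
    rw [mul_left_comm, ← Complex.exp_add]
    simp
  have hsplit : ∀ (p t : ℕ), Complex.exp (p * (ψ t + η : ℝ) * Complex.I) =
      Complex.exp (p * ψ t * Complex.I) * Complex.exp (p * η * Complex.I) := by
    intro p t
    rw [← Complex.exp_add]
    push_cast
    ring_nf
  have hsum : ∑ t ∈ Finset.range T, w t *
      (∑ p ∈ Finset.Icc 1 L, Complex.exp (p * (ψ t + η : ℝ) * Complex.I) * D p).re ≤
      ∑ t ∈ Finset.range T, w t * b :=
    Finset.sum_le_sum fun t _ => mul_le_mul_of_nonneg_left (h _) (hwnn t)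
  rw [← Finset.sum_mul, hW0] at hsum
  have hlhs : ∑ t ∈ Finset.range T, w t *
      (∑ p ∈ Finset.Icc 1 L, Complex.exp (p * (ψ t + η : ℝ) * Complex.I) * D p).re = T * ‖D q‖ := by
    have h5 : ∑ t ∈ Finset.range T, (w t : ℂ) *
        (∑ p ∈ Finset.Icc 1 L, Complex.exp (p * (ψ t + η : ℝ) * Complex.I) * D p) = T * ‖D q‖ := by
      simp only [Finset.mul_sum]
      rw [Finset.sum_comm, Finset.sum_eq_single q]
      · rw [← hWq, ← hrot, Finset.sum_mul]
        refine Finset.sum_congr rfl fun t _ => ?_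
        rw [hsplit]
        ring
      · intro p hp hpq
        have h6 := hWp p hp hpq
        calc _ = (∑ t ∈ Finset.range T, (w t : ℂ) * Complex.exp (p * ψ t * Complex.I)) *
              (Complex.exp (p * η * Complex.I) * D p) := by
              rw [Finset.sum_mul]
              refine Finset.sum_congr rfl fun t _ => ?_
              rw [hsplit]
              ring
          _ = 0 := by rw [h6, zero_mul]
      · intro hn
        exact absurd (Finset.mem_Icc.2 ⟨hq, hqL⟩) hn
    have h7 := congrArg Complex.re h5
    rw [Complex.re_sum] at h7
    simp only [Complex.re_ofReal_mul] at h7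
    rw [h7, ← Complex.ofReal_natCast, ← Complex.ofReal_mul, Complex.ofReal_re]
  rw [hlhs] at hsum
  rw [← hMr, ← hc]
  nlinarith [hsum, hT0]

/-! ### The Landau type inequality -/

section

variable {k : ℕ} {n : Fin k → ℕ}

theorem hasSum_multiDegree {φ : MultiWord n → ℂ} (hφ : Summable φ) :
    HasSum (fun p => ∑ α ∈ multiDegreeWords n p, φ α) (∑' α, φ α) := by
  have h := hφ.hasSum.tsum_fiberwise fun α i => (α i).length
  refine Eq.subst (motive := fun F => HasSum F (∑' α, φ α)) (funext fun p => ?_) h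
  symm
  rw [← Finset.tsum_subtype' (multiDegreeWords n p) φ]
  have hset : (fun (α : MultiWord n) i => (α i).length) ⁻¹' {p} =
      (multiDegreeWords n p : Set (MultiWord n)) := by
    ext α
    simp [mem_multiDegreeWords, funext_iff]
  rw [hset]

theorem hasSum_degree {φ : MultiWord n → ℂ} (hφ : Summable φ) :
    HasSum (fun q => ∑ α ∈ degreeWords n q, φ α) (∑' α, φ α) := by
  have h := hφ.hasSum.tsum_fiberwise fun α => ∑ i, (α i).length
  refine Eq.subst (motive := fun F => HasSum F (∑' α, φ α)) (funext fun q => ?_) h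
  symm
  rw [← Finset.tsum_subtype' (degreeWords n q) φ]
  have hset : (fun α : MultiWord n => ∑ i, (α i).length) ⁻¹' {q} =
      (degreeWords n q : Set (MultiWord n)) := by
    ext α
    simp [mem_degreeWords]
  rw [hset]

section ShiftForm

variable {G : Type*} [NormedAddCommGroup G] [InnerProductSpace ℂ G]

theorem finite_support_shiftForm (C : MultiWord n → (G →L[ℂ] G)) (B : Finset (MultiWord n))
    (g : MultiWord n → G) : (Function.support fun α => shiftForm C α B g).Finite := by
  classical
  have hfin : (⋃ β ∈ B, (fun α => α * β) ⁻¹' (B : Set (MultiWord n))).Finite :=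
    B.finite_toSet.biUnion fun β _ =>
      B.finite_toSet.preimage (mul_left_injective β).injOn
  refine hfin.subset fun α hα => ?_
  obtain ⟨β, hβ, hne⟩ := Finset.exists_ne_zero_of_sum_ne_zero (Function.mem_support.1 hα)
  refine Set.mem_biUnion hβ ?_
  by_contra h
  exact hne (if_neg h)

/-- The gauge rotation `g_β ↦ e^{i|β|θ} g_β` multiplies the form by `e^{i|α|θ}`. -/
theorem shiftForm_gauge (C : MultiWord n → (G →L[ℂ] G)) (α : MultiWord n)
    (B : Finset (MultiWord n)) (g : MultiWord n → G) (θ : ℝ) :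
    shiftForm C α B
        (fun β => Complex.exp ((∑ i, (β i).length : ℕ) * θ * Complex.I) • g β) =
      Complex.exp ((∑ i, (α i).length : ℕ) * θ * Complex.I) * shiftForm C α B g := by
  unfold shiftForm
  rw [Finset.mul_sum]
  refine Finset.sum_congr rfl fun β _ => ?_
  split_ifs
  · have hlen : ∑ i, ((α * β) i).length = ∑ i, (α i).length + ∑ i, (β i).length := by
      simp [Finset.sum_add_distrib]
    rw [map_smul, inner_smul_left, inner_smul_right, ← Complex.exp_conj, ← mul_assoc,
      ← Complex.exp_add, hlen]
    congr 2
    simp only [map_mul, Complex.conj_ofReal, Complex.conj_I, Complex.conj_natCast]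
    push_cast
    ring
  · simp

end ShiftForm

variable {K : Type*} [NormedAddCommGroup K] [InnerProductSpace ℂ K] 

theorem degreeWords_zero : degreeWords n 0 = {1} := by
  ext α
  rw [mem_degreeWords, Finset.mem_singleton]
  constructor
  · intro h
    funext i
    have := (Finset.sum_eq_zero_iff.1 h) i (Finset.mem_univ i)
    exact FreeMonoid.length_eq_zero.1 this
  · rintro rfl
    simp

theorem shiftForm_one (A : MultiWord n → (K →L[ℂ] K)) (B : Finset (MultiWord n))
    (g : MultiWord n → K) : shiftForm A 1 B g = ∑ β ∈ B, inner ℂ (A 1 (g β)) (g β) := by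
  unfold shiftForm
  refine Finset.sum_congr rfl fun β hβ => ?_
  rw [one_mul, if_pos hβ]

theorem isFormBound_zero (A : MultiWord n → (K →L[ℂ] K)) : IsFormBound A 0 ‖A 1‖ := by
  intro B g
  rw [degreeWords_zero, Finset.sum_singleton, shiftForm_one, Finset.mul_sum]
  refine (norm_sum_le _ _).trans (Finset.sum_le_sum fun β _ => ?_)
  refine (norm_inner_le_norm _ _).trans ?_
  rw [pow_two, ← mul_assoc]
  gcongr
  exact ContinuousLinearMap.le_opNorm _ _

/-- The condition `Re F ≤ I` at the points `r S`, tested on finitely supported vectors, in the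
limit `r → 1`. -/
theorem re_sum_shiftForm_le {A : MultiWord n → (K →L[ℂ] K)} (hF : IsFreeHolomorphic A)
    (hRe : ∀ (H : Type) [NormedAddCommGroup H] [InnerProductSpace ℂ H] [CompleteSpace H],
      ∀ X ∈ polyball n H, (1 / 2 : ℂ) • (freeEval A X + star (freeEval A X)) ≤ 1)
    (B : Finset (MultiWord n)) (g : MultiWord n → K) {L : ℕ}
    (hL : ∀ q, L < q → ∑ α ∈ degreeWords n q, shiftForm A α B g = 0) :
    (∑ q ∈ Finset.range (L + 1), ∑ α ∈ degreeWords n q, shiftForm A α B g).re ≤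
      ∑ β ∈ B, ‖g β‖ ^ 2 := by
  have key : ∀ r : ℝ, 0 ≤ r → r < 1 →
      (∑ q ∈ Finset.range (L + 1), (r : ℂ) ^ q * ∑ α ∈ degreeWords n q, shiftForm A α B g).re ≤
      ∑ β ∈ B, ‖g β‖ ^ 2 := by
    intro r h0 h1
    have hX := smul_universalModel_mem (n := n) h0 h1
    set X := (r : ℂ) • universalModel n with hXdef
    set v := tensorVector (fockBasis n) B g
    have hT : ∀ α β, wordEval X α (fockBasis n β) =
        ((r ^ (∑ i, (α i).length) : ℝ) : ℂ) • fockBasis n (α * β) := by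
      intro α β
      rw [hXdef, wordEval_smul, smul_apply,
        wordEval_apply_of_shift (universalModel_apply_basis n)]
      push_cast
      rfl
    set φ : MultiWord n → ℂ := fun α =>
      ((r ^ (∑ i, (α i).length) : ℝ) : ℂ) * shiftForm A α B g with hφ
    have hφs : Summable φ := by
      refine summable_of_hasFiniteSupport ((finite_support_shiftForm A B g).subset fun α hα => ?_)
      exact right_ne_zero_of_mul hα
    have hp := hasSum_multiDegree hφs
    have hinner : HasSum (fun p => inner ℂ v (multiPart A p X v)) (inner ℂ v (freeEval A X v)) :=
      (hF (FockSpace n) X hX).hasSum.mapL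
        ((innerSL ℂ v).comp (ContinuousLinearMap.apply ℂ _ v))
    have hstar : ∀ p, inner ℂ v (multiPart A p X v) =
        star (∑ α ∈ multiDegreeWords n p, φ α) := by
      intro p
      rw [← inner_conj_symm, multiPart, sum_apply, sum_inner]
      refine congrArg star (Finset.sum_congr rfl fun α _ => ?_)
      exact inner_opTensor_tensorVector (orthonormal_fockBasis n) A (hT α) B g
    simp only [hstar] at hinner
    have hval : inner ℂ v (freeEval A X v) = star (∑' α, φ α) := hinner.unique hp.star
    have hq : ∑' α, φ α = ∑ q ∈ Finset.range (L + 1), (r : ℂ) ^ q *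
        ∑ α ∈ degreeWords n q, shiftForm A α B g := by
      refine (hasSum_degree hφs).unique ?_
      have hterm : ∀ q, ∑ α ∈ degreeWords n q, φ α =
          (r : ℂ) ^ q * ∑ α ∈ degreeWords n q, shiftForm A α B g := by
        intro q
        rw [Finset.mul_sum]
        refine Finset.sum_congr rfl fun α hα => ?_
        rw [hφ, ← mem_degreeWords.1 hα]
        push_cast
        rfl
      simp only [hterm]
      refine hasSum_sum_of_ne_finset_zero fun q hq => ?_
      rw [hL q (by simpa using hq), mul_zero]
    rw [← hq, ← norm_tensorVector_sq (orthonormal_fockBasis n) B g]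
    have hpos := (ContinuousLinearMap.le_def _ _).1 (hRe (FockSpace n) X hX)
    have h2 := hpos.re_inner_nonneg_right v
    rw [sub_apply, one_apply_eq_self, inner_sub_right, map_sub, smul_apply, add_apply,
      inner_smul_right, inner_add_right, ContinuousLinearMap.star_eq_adjoint,
      ContinuousLinearMap.adjoint_inner_right, ← inner_conj_symm (freeEval A X v), hval,
      inner_self_eq_norm_sq] at h2
    have hre : ∀ z : ℂ, RCLike.re ((1 / 2 : ℂ) * (star z + (starRingEnd ℂ) (star z))) = z.re := by
      intro z
      change ((1 / 2 : ℂ) * (star z + (starRingEnd ℂ) (star z))).re = z.re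
      simp
      ring
    rw [hre] at h2
    linarith
  have hcont : Continuous fun r : ℝ => (∑ q ∈ Finset.range (L + 1), (r : ℂ) ^ q *
      ∑ α ∈ degreeWords n q, shiftForm A α B g).re := by fun_prop
  have hlim := (hcont.tendsto 1).mono_left (nhdsWithin_le_nhds (s := Set.Iio 1))
  simp only [Complex.ofReal_one, one_pow, one_mul] at hlim
  refine le_of_tendsto hlim ?_
  filter_upwards [self_mem_nhdsWithin, mem_nhdsWithin_of_mem_nhds (Ioi_mem_nhds zero_lt_one)]
    with r h1 h0
  exact key r (le_of_lt h0) h1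

theorem cos_pi_div_add_two_nonneg (N : ℕ) : 0 ≤ Real.cos (Real.pi / (N + 2)) := by
  have hpi := Real.pi_pos
  have h1 : Real.pi / (N + 2) ≤ Real.pi / 2 := by
    gcongr
    linarith [(Nat.cast_nonneg N : (0 : ℝ) ≤ N)]
  have h2 : 0 ≤ Real.pi / (N + 2) := by positivity
  exact Real.cos_nonneg_of_neg_pi_div_two_le_of_le (by linarith) h1

/-- Fejér's inequality, applied to the trigonometric polynomial in the gauge parameter `θ`. The
bound `L` on the degrees of the nonzero forms may be taken to be `m` when `m` is finite, and depends
on the finite family `g` when `m = ∞`. -/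
theorem norm_sum_shiftForm_le {A : MultiWord n → (K →L[ℂ] K)} (hF : IsFreeHolomorphic A)
    (hRe : ∀ (H : Type) [NormedAddCommGroup H] [InnerProductSpace ℂ H] [CompleteSpace H],
      ∀ X ∈ polyball n H, (1 / 2 : ℂ) • (freeEval A X + star (freeEval A X)) ≤ 1)
    (B : Finset (MultiWord n)) (g : MultiWord n → K) {L q : ℕ} (hq : 1 ≤ q) (hqL : q ≤ L)
    (hL : ∀ p, L < p → ∑ α ∈ degreeWords n p, shiftForm A α B g = 0) :
    ‖∑ α ∈ degreeWords n q, shiftForm A α B g‖ ≤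
      2 * Real.cos (Real.pi / ((L / q : ℕ) + 2)) * (‖1 - A 1‖ * ∑ β ∈ B, ‖g β‖ ^ 2) := by
  set D : ℕ → ℂ := fun p => ∑ α ∈ degreeWords n p, shiftForm A α B g with hD
  set b : ℝ := (∑ β ∈ B, ‖g β‖ ^ 2) - (D 0).re with hb
  have hpoly : ∀ θ : ℝ,
      (∑ p ∈ Finset.Icc 1 L, Complex.exp (p * θ * Complex.I) * D p).re ≤ b := by
    intro θ
    have hgauge : ∀ p, ∑ α ∈ degreeWords n p, shiftForm A α B
        (fun β => Complex.exp ((∑ i, (β i).length : ℕ) * θ * Complex.I) • g β) =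
        Complex.exp (p * θ * Complex.I) * D p := by
      intro p
      rw [hD, Finset.mul_sum]
      refine Finset.sum_congr rfl fun α hα => ?_
      rw [shiftForm_gauge, mem_degreeWords.1 hα]
    have h := re_sum_shiftForm_le hF hRe B
      (fun β => Complex.exp ((∑ i, (β i).length : ℕ) * θ * Complex.I) • g β) (L := L)
      (fun p hp => by rw [hgauge, hD]; simp only [hL p hp, mul_zero])
    have hnorm : ∀ β : MultiWord n,
        ‖Complex.exp ((∑ i, (β i).length : ℕ) * θ * Complex.I) • g β‖ = ‖g β‖ := by
      intro β
      rw [norm_smul, ← Complex.ofReal_natCast, ← Complex.ofReal_mul,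
        Complex.norm_exp_ofReal_mul_I, one_mul]
    simp only [hgauge, hnorm] at h
    rw [Finset.range_eq_Ico, Finset.sum_eq_sum_Ico_succ_bot (Nat.succ_pos L), Complex.add_re] at h
    simp only [Nat.cast_zero, zero_mul, Complex.exp_zero, one_mul, zero_add] at h
    rw [hb]
    have hIcc : Finset.Icc 1 L = Finset.Ico 1 (L + 1) := by ext; simp
    rw [hIcc]
    linarith
  have hmain := norm_coeff_le_of_trigPolynomial_nonneg hq hqL
    (Nat.lt_mul_div_succ L hq) b D hpoly
  have hble : b ≤ ‖1 - A 1‖ * ∑ β ∈ B, ‖g β‖ ^ 2 := by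
    rw [hb, hD, Finset.mul_sum]
    simp only [degreeWords_zero, Finset.sum_singleton, shiftForm_one, Complex.re_sum]
    rw [← Finset.sum_sub_distrib]
    refine Finset.sum_le_sum fun β _ => ?_
    have h1 : ‖g β‖ ^ 2 - (inner ℂ (A 1 (g β)) (g β)).re =
        RCLike.re (inner ℂ ((1 - A 1) (g β)) (g β)) := by
      rw [sub_apply, inner_sub_left, map_sub, one_apply_eq_self, inner_self_eq_norm_sq]
      rfl
    rw [h1]
    refine (RCLike.re_le_norm _).trans ((norm_inner_le_norm _ _).trans ?_)
    rw [pow_two, ← mul_assoc]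
    gcongr
    exact ContinuousLinearMap.le_opNorm _ _
  exact hmain.trans (mul_le_mul_of_nonneg_left hble
    (mul_nonneg zero_le_two (cos_pi_div_add_two_nonneg _)))

theorem isFormBound_of_re_le_one {A : MultiWord n → (K →L[ℂ] K)} {m : ℕ∞}
    (hdeg : ∀ α : MultiWord n, m < ((∑ i, (α i).length : ℕ) : ℕ∞) → A α = 0)
    (hF : IsFreeHolomorphic A)
    (hRe : ∀ (H : Type) [NormedAddCommGroup H] [InnerProductSpace ℂ H] [CompleteSpace H],
      ∀ X ∈ polyball n H, (1 / 2 : ℂ) • (freeEval A X + star (freeEval A X)) ≤ 1)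
    {q : ℕ} (hq : 1 ≤ q) (hqm : (q : ℕ∞) ≤ m) :
    IsFormBound A q (2 * ‖1 - A 1‖ * fejerCos m q) := by
  intro B g
  have hnn : 0 ≤ ‖1 - A 1‖ * ∑ β ∈ B, ‖g β‖ ^ 2 := by positivity
  rcases eq_or_ne m ⊤ with hm | hm
  · obtain ⟨L₀, hL₀⟩ := ((finite_support_shiftForm A B g).image
      fun α => ∑ i, (α i).length).bddAbove
    have h := norm_sum_shiftForm_le hF hRe B g hq (le_max_right L₀ q) fun p hp =>
      Finset.sum_eq_zero fun α hα => by
        by_contra hne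
        have h1 : ∑ i, (α i).length ≤ L₀ := hL₀ ⟨α, hne, rfl⟩
        rw [mem_degreeWords.1 hα] at h1
        exact absurd ((le_max_left L₀ q).trans_lt hp) (not_lt.2 h1)
    refine h.trans ?_
    rw [fejerCos, if_pos hm]
    nlinarith [Real.cos_le_one (Real.pi / ((max L₀ q / q : ℕ) + 2))]
  · lift m to ℕ using hm
    have h := norm_sum_shiftForm_le hF hRe B g hq (L := m) (by exact_mod_cast hqm) fun p hp =>
      Finset.sum_eq_zero fun α hα => by
        have h0 : A α = 0 := hdeg α (by rw [mem_degreeWords.1 hα]; exact_mod_cast hp)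
        unfold shiftForm
        simp [h0]
    refine h.trans_eq ?_
    rw [fejerCos, if_neg (ENat.natCast_ne_top m), ENat.toNat_natCast]
    ring

end

/-! ### The numbers `t_l` -/

theorem cos_pi_div_add_two_mono {a b : ℕ} (h : a ≤ b) :
    Real.cos (Real.pi / (a + 2)) ≤ Real.cos (Real.pi / (b + 2)) := by
  have hpi := Real.pi_pos
  refine Real.cos_le_cos_of_nonneg_of_le_pi (by positivity) ?_ (by gcongr)
  rw [div_le_iff₀ (by positivity)]
  nlinarith [(Nat.cast_nonneg a : (0 : ℝ) ≤ a)]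

theorem fejerCos_nonneg (m : ℕ∞) (q : ℕ) : 0 ≤ fejerCos m q := by
  unfold fejerCos
  split_ifs
  · exact zero_le_one
  · exact cos_pi_div_add_two_nonneg _

theorem one_half_le_cos {a : ℕ} (h : 1 ≤ a) : 1 / 2 ≤ Real.cos (Real.pi / (a + 2)) := by
  have h1 := cos_pi_div_add_two_mono h
  rwa [Nat.cast_one, show (1 : ℝ) + 2 = 3 by norm_num, Real.cos_pi_div_three] at h1

/-- The finite sum `∑_{q=1}^l t^q cos (π / ([l/q] + 2))`. -/
noncomputable def bohrSum (l : ℕ) (t : ℝ) : ℝ :=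
  ∑ q ∈ Finset.Icc 1 l, t ^ q * Real.cos (Real.pi / ((l / q : ℕ) + 2))

theorem isBohrSolution_natCast_iff {l : ℕ} {t : ℝ} :
    IsBohrSolution l t ↔ 0 < t ∧ t ≤ 1 ∧ bohrSum l t = 1 / 2 := by
  have key : ∀ (s : Set ℕ), s = Finset.Icc 1 l →
      HasSum (fun q : s => t ^ (q : ℕ) * fejerCos l q) (bohrSum l t) := by
    rintro _ rfl
    have h := (Finset.Icc 1 l).hasSum fun q => t ^ q * fejerCos l q
    have h2 : ∑ q ∈ Finset.Icc 1 l, t ^ q * fejerCos l q = bohrSum l t :=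
      Finset.sum_congr rfl fun q _ => by
        rw [fejerCos, if_neg (ENat.natCast_ne_top l), ENat.toNat_natCast]
    rwa [h2] at h
  have h := key {q : ℕ | 1 ≤ q ∧ (q : ℕ∞) ≤ l} (by ext q; simp)
  unfold IsBohrSolution
  refine and_congr_right fun _ => and_congr_right fun _ => ⟨fun h' => h.unique h', fun h' => ?_⟩
  rw [← h']
  exact h

theorem isBohrSolution_top_iff {t : ℝ} : IsBohrSolution ⊤ t ↔ t = 1 / 3 := by
  have hsum : ∀ t : ℝ, 0 < t → t < 1 →
      HasSum (fun q : {q : ℕ // 1 ≤ q ∧ (q : ℕ∞) ≤ ⊤} => t ^ (q : ℕ) * fejerCos ⊤ q)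
        ((1 - t)⁻¹ - 1) := by
    intro t h0 h1
    refine (hasSum_subtype_iff_indicator (s := {q : ℕ | 1 ≤ q ∧ (q : ℕ∞) ≤ ⊤})
      (f := fun q : ℕ => t ^ q * fejerCos ⊤ q)).2 ?_
    have h := (hasSum_geometric_of_lt_one h0.le h1).sub (hasSum_ite_eq (0 : ℕ) (1 : ℝ))
    refine Eq.subst (motive := fun F => HasSum F ((1 - t)⁻¹ - 1)) (funext fun q => ?_) h
    rcases Nat.eq_zero_or_pos q with rfl | hq
    · simp
    · have : q ∈ {q : ℕ | 1 ≤ q ∧ (q : ℕ∞) ≤ ⊤} := ⟨hq, le_top⟩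
      rw [Set.indicator_of_mem this, if_neg (by omega), fejerCos, if_pos rfl]
      simp
  constructor
  · rintro ⟨h0, h1, h⟩
    rcases h1.lt_or_eq with h1 | rfl
    · have h2 := (hsum t h0 h1).unique h
      have h3 : (1 - t)⁻¹ = 3 / 2 := by linarith
      have h4 : 1 - t = 2 / 3 := by rw [← inv_inv (1 - t), h3]; norm_num
      linarith
    · have h2 := le_hasSum h ⟨1, le_rfl, le_top⟩ fun q _ => by
        simp [fejerCos]
      simp [fejerCos] at h2
      norm_num at h2
  · rintro rfl
    refine ⟨by norm_num, by norm_num, ?_⟩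
    have h := hsum (1 / 3) (by norm_num) (by norm_num)
    norm_num at h ⊢
    exact h

theorem bohrSum_strictMonoOn {l : ℕ} (hl : 1 ≤ l) : StrictMonoOn (bohrSum l) (Set.Ici 0) := by
  intro s hs t _ hst
  refine Finset.sum_lt_sum (fun q _ => ?_) ⟨1, Finset.mem_Icc.2 ⟨le_rfl, hl⟩, ?_⟩
  · exact mul_le_mul_of_nonneg_right (pow_le_pow_left₀ hs hst.le q) (cos_pi_div_add_two_nonneg _)
  · rw [pow_one, pow_one, Nat.div_one]
    exact mul_lt_mul_of_pos_right hst (by linarith [one_half_le_cos hl])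

theorem continuous_bohrSum (l : ℕ) : Continuous (bohrSum l) := by
  unfold bohrSum
  fun_prop

theorem half_le_bohrSum_one {l : ℕ} (hl : 1 ≤ l) : 1 / 2 ≤ bohrSum l 1 := by
  have h := Finset.single_le_sum
    (f := fun q => (1 : ℝ) ^ q * Real.cos (Real.pi / ((l / q : ℕ) + 2)))
    (fun q _ => mul_nonneg (by positivity) (cos_pi_div_add_two_nonneg _))
    (Finset.mem_Icc.2 ⟨hl, le_rfl⟩ : l ∈ Finset.Icc 1 l)
  refine le_trans ?_ h
  simp only [one_pow, one_mul]
  exact one_half_le_cos (by rw [Nat.div_self hl])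

theorem bohrSum_lt_bohrSum {l₁ l₂ : ℕ} (h : l₁ < l₂) {t : ℝ} (ht : 0 < t) :
    bohrSum l₁ t < bohrSum l₂ t := by
  calc bohrSum l₁ t ≤ ∑ q ∈ Finset.Icc 1 l₁, t ^ q * Real.cos (Real.pi / ((l₂ / q : ℕ) + 2)) :=
        Finset.sum_le_sum fun q _ => mul_le_mul_of_nonneg_left
          (cos_pi_div_add_two_mono (Nat.div_le_div_right h.le)) (by positivity)
    _ < bohrSum l₂ t := by
        refine Finset.sum_lt_sum_of_subset (Finset.Icc_subset_Icc_right h.le)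
          (Finset.mem_Icc.2 ⟨by omega, le_rfl⟩ : l₂ ∈ Finset.Icc 1 l₂) (by simp; omega) ?_
          fun q _ _ => mul_nonneg (by positivity) (cos_pi_div_add_two_nonneg _)
        have := one_half_le_cos (a := l₂ / l₂) (by rw [Nat.div_self (by omega)])
        exact mul_pos (by positivity) (by linarith)

theorem exists_bohrSum_eq {l : ℕ} (hl : 1 ≤ l) : ∃ t, 0 < t ∧ t ≤ 1 ∧ bohrSum l t = 1 / 2 := by
  have h0 : bohrSum l 0 = 0 := Finset.sum_eq_zero fun q hq => by
    rw [zero_pow (by have := (Finset.mem_Icc.1 hq).1; omega), zero_mul]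
  obtain ⟨t, ⟨ht0, ht1⟩, ht⟩ := intermediate_value_Icc zero_le_one
    (continuous_bohrSum l).continuousOn
    (show (1 / 2 : ℝ) ∈ Set.Icc (bohrSum l 0) (bohrSum l 1) from
      ⟨by rw [h0]; norm_num, half_le_bohrSum_one hl⟩)
  refine ⟨t, ht0.lt_of_ne ?_, ht1, ht⟩
  rintro rfl
  rw [h0] at ht
  norm_num at ht

theorem sum_Icc_pow_mul_one_sub (t : ℝ) (l : ℕ) :
    (∑ q ∈ Finset.Icc 1 l, t ^ q) * (1 - t) = t - t ^ (l + 1) := by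
  induction l with
  | zero => simp
  | succ l ih =>
    rw [Finset.sum_Icc_succ_top (by omega), add_mul, ih]
    ring

theorem one_third_le_of_bohrSum_eq {l : ℕ} {t : ℝ} (ht0 : 0 < t) (ht : bohrSum l t = 1 / 2) :
    1 / 3 ≤ t := by
  by_contra! h
  have h1 : bohrSum l t ≤ ∑ q ∈ Finset.Icc 1 l, t ^ q := Finset.sum_le_sum fun q _ =>
    mul_le_of_le_one_right (by positivity) (Real.cos_le_one _)
  have h2 := sum_Icc_pow_mul_one_sub t l
  have h3 : 0 < t ^ (l + 1) := by positivity
  nlinarith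

theorem eventually_half_lt_bohrSum {s : ℝ} (hs : 1 / 3 < s) (hs1 : s < 1) :
    ∀ᶠ l in Filter.atTop, 1 / 2 < bohrSum l s := by
  have hs0 : 0 < s := by linarith
  obtain ⟨Q, hQ⟩ : ∃ Q : ℕ, 1 / 2 < ∑ q ∈ Finset.Icc 1 Q, s ^ q := by
    have hlim := (tendsto_pow_atTop_nhds_zero_of_lt_one hs0.le hs1).comp
      (Filter.tendsto_add_atTop_nat 1)
    obtain ⟨Q, hQ⟩ := (hlim.eventually (gt_mem_nhds (show 0 < s - (1 - s) / 2 by linarith))).exists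
    refine ⟨Q, ?_⟩
    have h2 := sum_Icc_pow_mul_one_sub s Q
    simp only [Function.comp_apply] at hQ
    nlinarith
  have hlim : Filter.Tendsto (fun l : ℕ => ∑ q ∈ Finset.Icc 1 Q,
      s ^ q * Real.cos (Real.pi / ((l / q : ℕ) + 2))) Filter.atTop
      (𝓝 (∑ q ∈ Finset.Icc 1 Q, s ^ q)) := by
    refine tendsto_finsetSum _ fun q hq => ?_
    have hdiv : Filter.Tendsto (fun l : ℕ => ((l / q : ℕ) : ℝ) + 2) Filter.atTop Filter.atTop :=
      Filter.tendsto_atTop_add_const_right _ _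
        (tendsto_natCast_atTop_atTop.comp (Nat.tendsto_div_const_atTop
          (by have := (Finset.mem_Icc.1 hq).1; omega)))
    have hcos := (Real.continuous_cos.tendsto 0).comp (hdiv.const_div_atTop Real.pi)
    rw [Real.cos_zero] at hcos
    simpa using hcos.const_mul (s ^ q)
  filter_upwards [hlim.eventually (lt_mem_nhds hQ), Filter.eventually_ge_atTop Q] with l h1 h2
  refine h1.trans_le (Finset.sum_le_sum_of_subset_of_nonneg (Finset.Icc_subset_Icc_right h2)
    fun q _ _ => mul_nonneg (by positivity) (cos_pi_div_add_two_nonneg _))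

/-- The solutions `t_l` exist by the intermediate value theorem, are unique since the sums increase
with `t`, and decrease since the sums increase with `l`; they tend to `1/3` since
`cos (π / ([l/q] + 2)) → 1` for each `q`, the limiting series being `t / (1 - t)`. -/
theorem exists_bohr_numbers : ∃ t : ℕ∞ → ℝ,
    (∀ l : ℕ∞, 1 ≤ l → ∀ s : ℝ, IsBohrSolution l s ↔ s = t l) ∧
    (∀ l : ℕ∞, 2 ≤ l → t l < 1) ∧
    (∀ l₁ l₂ : ℕ, 1 ≤ l₁ → l₁ < l₂ → t l₂ < t l₁) ∧
    Filter.Tendsto (fun l : ℕ => t l) Filter.atTop (𝓝 (1 / 3)) ∧ t ⊤ = 1 / 3 := by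
  have hex : ∀ l : ℕ, ∃ t, 1 ≤ l → 0 < t ∧ t ≤ 1 ∧ bohrSum l t = 1 / 2 := by
    intro l
    by_cases hl : 1 ≤ l
    · obtain ⟨t, ht⟩ := exists_bohrSum_eq hl
      exact ⟨t, fun _ => ht⟩
    · exact ⟨0, fun h => absurd h hl⟩
  choose τ hτ using hex
  have hanti : ∀ l₁ l₂ : ℕ, 1 ≤ l₁ → l₁ < l₂ → τ l₂ < τ l₁ := by
    intro l₁ l₂ h1 h12
    obtain ⟨ha, -, hb⟩ := hτ l₁ h1
    obtain ⟨hc, -, hd⟩ := hτ l₂ (by omega)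
    by_contra! h
    have h3 := bohrSum_lt_bohrSum h12 ha
    have h4 := (bohrSum_strictMonoOn (by omega : 1 ≤ l₂)).monotoneOn ha.le hc.le h
    linarith
  refine ⟨fun l => if l = ⊤ then 1 / 3 else τ l.toNat, ?_, ?_, ?_, ?_, if_pos rfl⟩
  · intro l hl s
    rcases eq_or_ne l ⊤ with rfl | hne
    · simp only [if_true, isBohrSolution_top_iff]
    · lift l to ℕ using hne
      have hl' : 1 ≤ l := by exact_mod_cast hl
      simp only [ENat.natCast_ne_top, if_false, ENat.toNat_natCast, isBohrSolution_natCast_iff]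
      obtain ⟨ha, hb, hc⟩ := hτ l hl'
      constructor
      · rintro ⟨h0, -, h⟩
        exact (bohrSum_strictMonoOn hl').injOn h0.le ha.le (h.trans hc.symm)
      · rintro rfl
        exact ⟨ha, hb, hc⟩
  · intro l hl
    rcases eq_or_ne l ⊤ with rfl | hne
    · norm_num
    · lift l to ℕ using hne
      have hl' : 2 ≤ l := by exact_mod_cast hl
      simp only [ENat.natCast_ne_top, if_false, ENat.toNat_natCast]
      exact (hanti 1 l le_rfl (by omega)).trans_le (hτ 1 le_rfl).2.1
  · intro l₁ l₂ h1 h12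
    simpa using hanti l₁ l₂ h1 h12
  · simp only [ENat.natCast_ne_top, if_false, ENat.toNat_natCast]
    refine tendsto_order.2 ⟨fun a ha => ?_, fun s hs => ?_⟩
    · filter_upwards [Filter.eventually_ge_atTop 1] with l hl
      exact ha.trans_le (one_third_le_of_bohrSum_eq (hτ l hl).1 (hτ l hl).2.2)
    · obtain ⟨s', hs', hs'1⟩ := exists_between (lt_min hs (by norm_num : (1 / 3 : ℝ) < 1))
      filter_upwards [eventually_half_lt_bohrSum hs' (hs'1.trans_le (min_le_right _ _)),
        Filter.eventually_ge_atTop 1] with l h1 hl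
      refine lt_trans ?_ (hs'1.trans_le (min_le_left _ _))
      by_contra! h
      have := (bohrSum_strictMonoOn hl).monotoneOn (by linarith : (0 : ℝ) ≤ s') (hτ l hl).1.le h
      linarith [(hτ l hl).2.2]

/-! ### The Bohr type inequality -/

theorem numericalRadius_smul {E : Type*} [NormedAddCommGroup E] [InnerProductSpace ℂ E]
    (c : ℂ) (T : E →L[ℂ] E) : numericalRadius (c • T) = ‖c‖ * numericalRadius T := by
  unfold numericalRadius
  rw [Real.mul_iSup_of_nonneg (norm_nonneg c)]
  simp [mul_comm]

theorem exists_orthonormal_of_countable {ι E : Type*} [Countable ι] [NormedAddCommGroup E]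
    [InnerProductSpace ℂ E] (hE : ¬ FiniteDimensional ℂ E) : ∃ f : ι → E, Orthonormal ℂ f := by
  obtain ⟨e, he⟩ := exists_injective_nat ι
  set b := Module.Basis.ofVectorSpace ℂ E
  have hinf : Infinite (Module.Basis.ofVectorSpaceIndex ℂ E) := by
    by_contra h
    rw [not_infinite_iff_finite] at h
    exact hE (Module.Finite.of_basis b)
  set u : ℕ → E := b ∘ Infinite.natEmbedding _
  have hu : LinearIndependent ℂ u :=
    b.linearIndependent.comp _ (Infinite.natEmbedding _).injective
  exact ⟨_, (InnerProductSpace.gramSchmidtNormed_orthonormal hu).comp e he⟩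

section

variable {k : ℕ} {n : Fin k → ℕ} {K : Type*} [NormedAddCommGroup K] [InnerProductSpace ℂ K]
  [CompleteSpace K] {E : Type*} [NormedAddCommGroup E] [InnerProductSpace ℂ E] [CompleteSpace E]

theorem exists_isometry_fockSpace (hE : ¬ FiniteDimensional ℂ E) :
    Nonempty (FockSpace n →ₗᵢ[ℂ] E) := by
  have : ∀ i, Countable (FreeMonoid (Fin (n i))) := fun i =>
    inferInstanceAs (Countable (List (Fin (n i))))
  obtain ⟨f, hf⟩ := exists_orthonormal_of_countable (ι := MultiWord n) hE
  exact ⟨hf.orthogonalFamily.linearIsometry⟩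

theorem numericalRadius_homPart_le_of_mem_smul_closure (A : MultiWord n → (K →L[ℂ] K)) (q : ℕ)
    {r : ℝ} (hr : 0 ≤ r) {X : OpTuple n E} (hX : X ∈ (r : ℂ) • closure (polyball n E)) :
    numericalRadius (homPart A q X) ≤ numericalRadius (homPart A q (universalModel n)) * r ^ q := by
  obtain ⟨Y, hY, rfl⟩ := hX
  change numericalRadius (homPart A q ((r : ℂ) • Y)) ≤ _
  rw [homPart_smul, numericalRadius_smul, norm_pow, Complex.norm_real, Real.norm_of_nonneg hr,
    mul_comm]
  exact mul_le_mul_of_nonneg_right (numericalRadius_homPart_le_universalModel A q hY)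
    (by positivity)

theorem bddAbove_numericalRadius_homPart (A : MultiWord n → (K →L[ℂ] K)) (q : ℕ) {r : ℝ}
    (hr : 0 ≤ r) : BddAbove (Set.range fun X : ((r : ℂ) • closure (polyball n E) : Set _) =>
      numericalRadius (homPart A q (X : OpTuple n E))) := by
  refine ⟨numericalRadius (homPart A q (universalModel n)) * r ^ q, ?_⟩
  rintro _ ⟨X, rfl⟩
  exact numericalRadius_homPart_le_of_mem_smul_closure A q hr X.2

theorem iSup_numericalRadius_homPart (A : MultiWord n → (K →L[ℂ] K)) (q : ℕ) {r : ℝ}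
    (hr : 0 ≤ r) (hE : ¬ FiniteDimensional ℂ E) :
    ⨆ X : ((r : ℂ) • closure (polyball n E) : Set _),
      numericalRadius (homPart A q (X : OpTuple n E)) =
    numericalRadius (homPart A q (universalModel n)) * r ^ q := by
  obtain ⟨V⟩ := exists_isometry_fockSpace (n := n) hE
  have hmem : (r : ℂ) • modelCopy V ∈ (r : ℂ) • closure (polyball n E) :=
    Set.smul_mem_smul_set (modelCopy_mem_closure V)
  refine le_antisymm (Real.iSup_le (fun X =>
    numericalRadius_homPart_le_of_mem_smul_closure A q hr X.2)
    (mul_nonneg (numericalRadius_nonneg _) (by positivity))) ?_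
  have hval : numericalRadius (homPart A q ((r : ℂ) • modelCopy V)) =
      numericalRadius (homPart A q (universalModel n)) * r ^ q := by
    rw [homPart_smul, numericalRadius_smul, norm_pow, Complex.norm_real, Real.norm_of_nonneg hr,
      numericalRadius_homPart_modelCopy, mul_comm]
  rw [← hval]
  exact le_ciSup (bddAbove_numericalRadius_homPart A q hr) ⟨_, hmem⟩

/-- Summation of coefficient bounds `ω_q ≤ 2 b cos (π / ([m/q] + 2))`, `ω_0 ≤ a`, up to the radius
at which the majorant series takes the value `a + b`. -/
theorem summable_and_tsum_le_of_bohrSolution {m : ℕ∞} {t r a b : ℝ} {ω : ℕ → ℝ}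
    (ht : IsBohrSolution m t) (hr0 : 0 ≤ r) (hrt : r ≤ t) (hω : ∀ q, 0 ≤ ω q)
    (ha : ω 0 ≤ a) (hb : ∀ q : ℕ, 1 ≤ q → (q : ℕ∞) ≤ m → ω q ≤ 2 * b * fejerCos m q) :
    Summable (fun q : {q : ℕ // (q : ℕ∞) ≤ m} => ω q * r ^ (q : ℕ)) ∧
      ∑' q : {q : ℕ // (q : ℕ∞) ≤ m}, ω q * r ^ (q : ℕ) ≤ a + b := by
  classical
  set s : Set ℕ := {q : ℕ | (q : ℕ∞) ≤ m} with hs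
  have h1 := (hasSum_subtype_iff_indicator (s := {q : ℕ | 1 ≤ q ∧ (q : ℕ∞) ≤ m})
    (f := fun q : ℕ => t ^ q * fejerCos m q)).1 ht.2.2
  have hmaj := (hasSum_ite_eq (0 : ℕ) a).add (h1.mul_left (2 * b))
  rw [show a + 2 * b * (1 / 2) = a + b by ring] at hmaj
  have hnn : ∀ q, 0 ≤ s.indicator (fun q => ω q * r ^ q) q := fun q =>
    Set.indicator_nonneg (fun q _ => mul_nonneg (hω q) (by positivity)) q
  have hle : ∀ q, s.indicator (fun q => ω q * r ^ q) q ≤ (if q = 0 then a else 0) +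
      2 * b * {q : ℕ | 1 ≤ q ∧ (q : ℕ∞) ≤ m}.indicator (fun q => t ^ q * fejerCos m q) q := by
    intro q
    by_cases hq : q ∈ s
    · rw [Set.indicator_of_mem hq]
      rcases Nat.eq_zero_or_pos q with rfl | hq0
      · simpa using ha
      · have hmem : q ∈ {q : ℕ | 1 ≤ q ∧ (q : ℕ∞) ≤ m} := ⟨hq0, hq⟩
        rw [if_neg (by omega), Set.indicator_of_mem hmem, zero_add]
        have hωq := hb q hq0 hq
        calc ω q * r ^ q ≤ (2 * b * fejerCos m q) * t ^ q :=
              mul_le_mul hωq (pow_le_pow_left₀ hr0 hrt q) (by positivity) ((hω q).trans hωq)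
          _ = _ := by ring
    · have hmem : q ∉ {q : ℕ | 1 ≤ q ∧ (q : ℕ∞) ≤ m} := fun h => hq h.2
      have hq0 : q ≠ 0 := by
        rintro rfl
        exact hq (by simp [hs])
      rw [Set.indicator_of_notMem hq, Set.indicator_of_notMem hmem, if_neg hq0]
      simp
  have hsum := Summable.of_nonneg_of_le hnn hle hmaj.summable
  refine ⟨summable_subtype_iff_indicator.2 hsum, ?_⟩
  have heq : ∑' q : s, ω q * r ^ (q : ℕ) = ∑' q, s.indicator (fun q => ω q * r ^ q) q :=
    tsum_subtype s fun q => ω q * r ^ q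
  exact heq.trans_le (hasSum_le hle hsum.hasSum hmaj)

end

end NCPolyball

theorem mainTheorem8 {k : ℕ} (hk : 1 ≤ k) (n : Fin k → ℕ) (hn : ∀ i, 1 ≤ n i)
    {K : Type*} [NormedAddCommGroup K] [InnerProductSpace ℂ K] [CompleteSpace K]
    (m : ℕ∞) (hm : 1 ≤ m)
    (A : MultiWord n → (K →L[ℂ] K))
    (hdeg : ∀ α : MultiWord n, m < ((∑ i, (α i).length : ℕ) : ℕ∞) → A α = 0)
    (hF : IsFreeHolomorphic A)
    (hF0 : ∀ (H : Type) [NormedAddCommGroup H] [InnerProductSpace ℂ H] [CompleteSpace H],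
      0 ≤ freeEval A (0 : OpTuple n H))
    (hRe : ∀ (H : Type) [NormedAddCommGroup H] [InnerProductSpace ℂ H] [CompleteSpace H],
      ∀ X ∈ polyball n H, (1 / 2 : ℂ) • (freeEval A X + star (freeEval A X)) ≤ 1) :
    -- the Landau type inequality
    (∀ q : ℕ, 1 ≤ q → (q : ℕ∞) ≤ m →
      (∀ (E : Type*) [NormedAddCommGroup E] [InnerProductSpace ℂ E] [CompleteSpace E],
        ∀ X ∈ polyball n E,
          numericalRadius (homPart A q X) ≤ numericalRadius (homPart A q (universalModel n))) ∧
      numericalRadius (homPart A q (universalModel n)) ≤ 2 * ‖1 - A 1‖ * fejerCos m q) ∧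
    -- the numbers `t_l`, `l ∈ {1, 2, …} ∪ {∞}`, and the Bohr type inequality
    ∃ t : ℕ∞ → ℝ,
      (∀ l : ℕ∞, 1 ≤ l → ∀ s : ℝ, IsBohrSolution l s ↔ s = t l) ∧
      (∀ l : ℕ∞, 2 ≤ l → t l < 1) ∧
      (∀ l₁ l₂ : ℕ, 1 ≤ l₁ → l₁ < l₂ → t l₂ < t l₁) ∧
      Filter.Tendsto (fun l : ℕ => t l) Filter.atTop (𝓝 (1 / 3)) ∧
      t ⊤ = 1 / 3 ∧
      ∀ r : ℝ, 0 ≤ r → r ≤ t m →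
        Summable (fun q : {q : ℕ // (q : ℕ∞) ≤ m} =>
          numericalRadius (homPart A q (universalModel n)) * r ^ (q : ℕ)) ∧
        (∀ (E : Type*) [NormedAddCommGroup E] [InnerProductSpace ℂ E] [CompleteSpace E],
          ¬ FiniteDimensional ℂ E →
          (∀ q : ℕ, BddAbove (Set.range fun X : ((r : ℂ) • closure (polyball n E) : Set _) =>
            numericalRadius (homPart A q (X : OpTuple n E)))) ∧
          HasSum (fun q : {q : ℕ // (q : ℕ∞) ≤ m} =>
              ⨆ X : ((r : ℂ) • closure (polyball n E) : Set _),
                numericalRadius (homPart A q (X : OpTuple n E)))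
            (∑' q : {q : ℕ // (q : ℕ∞) ≤ m},
              numericalRadius (homPart A q (universalModel n)) * r ^ (q : ℕ))) ∧
        ∑' q : {q : ℕ // (q : ℕ∞) ≤ m},
            numericalRadius (homPart A q (universalModel n)) * r ^ (q : ℕ)
          ≤ ‖A 1‖ + ‖1 - A 1‖ := by
  have hform : ∀ q : ℕ, 1 ≤ q → (q : ℕ∞) ≤ m →
      numericalRadius (homPart A q (universalModel n)) ≤ 2 * ‖1 - A 1‖ * fejerCos m q := by
    intro q hq hqm
    refine (isFormBound_of_re_le_one hdeg hF hRe hq hqm).numericalRadius_homPart_le ?_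
      universalModel_mem_closure
    exact mul_nonneg (by positivity) (fejerCos_nonneg m q)
  refine ⟨fun q hq hqm => ⟨fun E _ _ _ X hX =>
    numericalRadius_homPart_le_universalModel A q (subset_closure hX), hform q hq hqm⟩, ?_⟩
  obtain ⟨t, ht, ht1, hanti, hlim, htop⟩ := exists_bohr_numbers
  refine ⟨t, ht, ht1, hanti, hlim, htop, fun r hr0 hrt => ?_⟩
  obtain ⟨hsum, hle⟩ := summable_and_tsum_le_of_bohrSolution ((ht m hm _).2 rfl) hr0 hrt
    (fun q => numericalRadius_nonneg (homPart A q (universalModel n)))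
    ((isFormBound_zero A).numericalRadius_homPart_le (norm_nonneg _) universalModel_mem_closure)
    hform
  refine ⟨hsum, fun E _ _ _ hE => ⟨fun q => bddAbove_numericalRadius_homPart A q hr0, ?_⟩, hle⟩
  simp only [iSup_numericalRadius_homPart A _ hr0 hE]
  exact hsum.hasSum
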